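/- Let $M^3\subset\mathbb{C}^2$ be a local real-analytic hypersurface passing through the origin, that is, the zero set in an open neighbourhood of $0$ of a real-valued real-analytic function $\rho$ with $\rho(0)=0$ and $d\rho\neq 0$ at every point of this zero set. Let $T^{1,0}M\subset\mathbb{C}\otimes_{\mathbb{R}}TM$ be the complex line bundle of those vectors of $\mathbb{C}\otimes_{\mathbb{R}}TM$ on which the complex structure of $\mathbb{C}^2$ acts as multiplication by $\sqrt{-1}$. Suppose that $M$ belongs to the general Class I: for any local real-analytic vector field generator $\mathcal{L}$ of $T^{1,0}M$, the three fields $$\mathcal{L},\qquad \overline{\mathcal{L}},\qquad [\mathcal{L},\overline{\mathcal{L}}]$$ constitute a frame for $\mathbb{C}\otimes_{\mathbb{R}}TM$ wherever $\mathcal{L}$ is defined. Then there are local holomorphic coordinates $(z,w)$ on $\mathbb{C}^2$ near $0$, centred at $0$, with $w=u+\sqrt{-1}\,v$, in which $M$ is represented near the origin by a real-analytic equation of the form $$v = z\bar z + z\bar z\,O_1(z,\bar z) + z\bar z\,O_1(u).$$ Here $O_1(z,\bar z)$ denotes a real-valued real-analytic function $A(z,\bar z)$ near $0$ with $A(0,0)=0$,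 and $O_1(u)$ denotes a function $u\,B(z,\bar z,u)$ with $B$ real-valued and real-analytic near $0$. -/

import Mathlib

open scoped TensorProduct

noncomputable section

/-- The space of the variables `(z, w)`. -/
abbrev C2 : Type := ℂ × ℂ

/-- The complexified tangent space `ℂ ⊗_ℝ T_p ℂ²`, where `T_p ℂ² = ℂ²` as a real vector space. -/
abbrev CT : Type := ℂ ⊗[ℝ] C2

/-- The standard complex structure of `ℂ²`, as a real-linear map. -/
def complexStructure : C2 →ₗ[ℝ] C2 :=
  (LinearMap.lsmul ℂ C2 Complex.I).restrictScalars ℝ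

/-- A local real analytic hypersurface `M³ ⊂ ℂ²` passing through the origin: the zero set, in an
open neighbourhood `dom` of the origin, of a real analytic function `ρ` whose differential
vanishes at no point of that zero set. -/
structure LocalHypersurface where
  dom : Set C2
  isOpen_dom : IsOpen dom
  ρ : C2 → ℝ
  analytic : AnalyticOnNhd ℝ ρ dom
  fderiv_ne_zero : ∀ p ∈ dom, ρ p = 0 → fderiv ℝ ρ p ≠ 0
  zero_mem_dom : (0 : C2) ∈ dom
  ρ_zero : ρ 0 = 0

namespace LocalHypersurface

/-- The set of points of the hypersurface. -/
def carrier (M : LocalHypersurface) : Set C2 := {p | p ∈ M.dom ∧ M.ρ p = 0}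

/-- The real tangent space `T_p M`, of real dimension 3 at each point `p` of `M`. -/
def tangent (M : LocalHypersurface) (p : C2) : Submodule ℝ C2 :=
  LinearMap.ker (fderiv ℝ M.ρ p : C2 →ₗ[ℝ] ℝ)

/-- The complexified tangent space `ℂ ⊗_ℝ T_p M`. -/
def complexTangent (M : LocalHypersurface) (p : C2) : Submodule ℂ CT :=
  (M.tangent p).baseChange ℂ

/-- `T^{1,0}_p M`: the vectors of `ℂ ⊗_ℝ T_p M` on which the complex structure acts as `i`. -/
def holTangent (M : LocalHypersurface) (p : C2) : Submodule ℂ CT :=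
  M.complexTangent p ⊓ Module.End.eigenspace (complexStructure.baseChange ℂ) Complex.I

end LocalHypersurface

/-- A complex vector field `X + i Y` on (a part of) `ℂ²`, i.e. a section of `ℂ ⊗_ℝ T ℂ²`, given by
its real and imaginary parts. -/
structure CVectorField where
  re : C2 → C2
  im : C2 → C2

namespace CVectorField

/-- The value of the vector field at a point. -/
def eval (L : CVectorField) (p : C2) : CT :=
  (1 : ℂ) ⊗ₜ[ℝ] L.re p + Complex.I ⊗ₜ[ℝ] L.im p

/-- The complex conjugate vector field. -/
def conj (L : CVectorField) : CVectorField where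
  re := L.re
  im := fun p => -L.im p

/-- The Lie bracket of complex vector fields: the complex-bilinear extension of the Lie bracket of
real vector fields. When both fields are tangent to a hypersurface along it, the bracket of these
fields on the hypersurface is the restriction of this one. -/
def bracket (K L : CVectorField) : CVectorField where
  re := fun p => VectorField.lieBracket ℝ K.re L.re p - VectorField.lieBracket ℝ K.im L.im p
  im := fun p => VectorField.lieBracket ℝ K.re L.im p + VectorField.lieBracket ℝ K.im L.re p

end CVectorField

namespace LocalHypersurface

/-- `L` is a (real analytic) local vector field generator of `T^{1,0}M` over the open part `M ∩ W`
of `M`. The field is taken on the open set `W` of `ℂ²`; only its values on `M` are constrained. -/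
def IsGenerator (M : LocalHypersurface) (W : Set C2) (L : CVectorField) : Prop :=
  IsOpen W ∧ AnalyticOnNhd ℝ L.re W ∧ AnalyticOnNhd ℝ L.im W ∧
    ∀ p ∈ M.carrier ∩ W, L.eval p ≠ 0 ∧ M.holTangent p = Submodule.span ℂ {L.eval p}

/-- The three fields constitute a frame for `ℂ ⊗_ℝ TM` over `M ∩ W`. -/
def IsFrame (M : LocalHypersurface) (W : Set C2) (F : Fin 3 → CVectorField) : Prop :=
  ∀ p ∈ M.carrier ∩ W, LinearIndependent ℂ (fun i => (F i).eval p) ∧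
    Submodule.span ℂ (Set.range fun i => (F i).eval p) = M.complexTangent p

/-- General Class I: for any local vector field generator `L` of `T^{1,0}M`, the fields
`L`, `conj L`, `[L, conj L]` constitute a frame for `ℂ ⊗_ℝ TM`. -/
def IsClassI (M : LocalHypersurface) : Prop :=
  ∀ (W : Set C2) (L : CVectorField), M.IsGenerator W L →
    M.IsFrame W ![L, L.conj, L.bracket L.conj]

end LocalHypersurface

/-- Local holomorphic coordinates of `ℂ²` centred at the origin: a biholomorphism `Φ` between two
open neighbourhoods `Φ.source` and `Φ.target` of the origin, which fixes the origin. -/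
structure IsLocalHolCoord (Φ : OpenPartialHomeomorph C2 C2) : Prop where
  zero_mem : (0 : C2) ∈ Φ.source
  map_zero : Φ 0 = 0
  hol : DifferentiableOn ℂ Φ Φ.source
  hol_symm : DifferentiableOn ℂ Φ.symm Φ.target

end

/-! Polarize the defining function: `ρ` is the restriction to `q = p̄` of a holomorphic `P (p, q)`
satisfying the reality condition `P (q̄, p̄) = conj (P (p, q))`. The zero sets of `P (·, q)` are the
Segre varieties. Near the origin, `p` lies on exactly one Segre variety with `q = (0, s)`, and `s =
S p` is holomorphic in `p`. The function `½ (S p + conj (S (0, conj (S p))))` depends on `S` alone.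
Taken as second coordinate, it turns these varieties into the level sets of `w`, labelled so that
the polarized function vanishes at `χ = 0`, `w = τ`, where `(χ, τ)` are the coordinates conjugate to
`(z, w)`. By reality it also vanishes at `z = 0`, `w = τ` (`exists_normal_polarization`).

Put `w = u + iv` and `τ = u - iv` with `u`, `v` independent. At `v = 0` the polarized function is
then divisible by `zχ`, so `ρ = |z|² K (z, u) + v L (z, u, v)` (`exists_normal_coordinates`). Every
division rests on the power series argument `AnalyticAt.exists_eq_add_smul`.

Two constants remain. `L 0` is the coefficient of `v` in the differential of `ρ`, and `4 K 0` is the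
Levi form, read on the disc `w = 0` (`leviForm_eq_of_disc`). Class I makes the Levi form nonzero:
otherwise `[ℒ, conj ℒ]` would be a combination of `ℒ` and `conj ℒ` at the origin
(`leviForm_ne_zero`). A preliminary linear change can therefore arrange `K 0 = -L 0`. Substituting
`v = |z|² t` and applying the implicit function theorem gives `v = |z|² F (z, u)` with `F 0 = 1`
(`exists_graph`), and `F (z, u) = F (z, 0) + u B` is the required form. -/

open Filter Topology ComplexConjugate

/-! ### Power series and division by a linear form -/

section PowerSeries

variable {𝕜 : Type*} [NontriviallyNormedField 𝕜]
  {E : Type*} [NormedAddCommGroup E] [NormedSpace 𝕜 E]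
  {F : Type*} [NormedAddCommGroup F] [NormedSpace 𝕜 F]

lemma FormalMultilinearSeries.radius_pos_of_le_geometric (p : FormalMultilinearSeries 𝕜 E F)
    {C r : ℝ} (hr : 0 < r) (h : ∀ n, ‖p n‖ ≤ C * r ^ n) : 0 < p.radius := by
  have h1 : ((r⁻¹).toNNReal : ENNReal) ≤ p.radius := by
    apply p.le_radius_of_bound C
    intro n
    rw [Real.coe_toNNReal _ (by positivity)]
    calc ‖p n‖ * (r⁻¹) ^ n ≤ C * r ^ n * (r⁻¹) ^ n := by gcongr; exact h n
      _ = C := by rw [mul_assoc, ← mul_pow, mul_inv_cancel₀ hr.ne']; simp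
  refine lt_of_lt_of_le ?_ h1
  simpa using hr

/-- Analyticity at the origin in terms of a geometrically bounded power series. -/
lemma analyticAt_zero_iff_hasSum {f : E → F} :
    AnalyticAt 𝕜 f 0 ↔ ∃ (p : FormalMultilinearSeries 𝕜 E F) (C r : ℝ), 0 < r ∧
      (∀ n, ‖p n‖ ≤ C * r ^ n) ∧ ∀ᶠ x in 𝓝 (0 : E), HasSum (fun n => p n fun _ => x) (f x) := by
  constructor
  · rintro ⟨p, hp⟩
    obtain ⟨C, r, -, hr, h⟩ := p.le_mul_pow_of_radius_pos hp.radius_pos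
    refine ⟨p, C, r, hr, h, ?_⟩
    simpa using hp.eventually_hasSum
  · rintro ⟨p, C, r, hr, h, hs⟩
    obtain ⟨ε, hε, hs⟩ := Metric.eventually_nhds_iff.1 hs
    refine ⟨p, min p.radius (ENNReal.ofReal ε), min_le_left _ _, ?_, ?_⟩
    · exact lt_min (p.radius_pos_of_le_geometric hr h) (ENNReal.ofReal_pos.2 hε)
    · intro y hy
      rw [zero_add]
      apply hs
      have : y ∈ Metric.eball (0 : E) (ENNReal.ofReal ε) :=
        Metric.eball_subset_eball (min_le_right _ _) hy
      rwa [Metric.eball_ofReal] at this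

lemma FormalMultilinearSeries.analyticAt_sum [CompleteSpace F] (p : FormalMultilinearSeries 𝕜 E F)
    {C r : ℝ} (hr : 0 < r) (h : ∀ n, ‖p n‖ ≤ C * r ^ n) :
    AnalyticAt 𝕜 p.sum 0 ∧ ∀ᶠ x in 𝓝 (0 : E), HasSum (fun n => p n fun _ => x) (p.sum x) := by
  have h1 := (p.hasFPowerSeriesOnBall (p.radius_pos_of_le_geometric hr h)).hasFPowerSeriesAt
  exact ⟨h1.analyticAt, by simpa using h1.eventually_hasSum⟩

/-- The telescoping expansion of `p (x, …, x) - p (A x, …, A x)` for `A x = x - φ x • e`. -/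
lemma ContinuousMultilinearMap.exists_sub_eq_smul {n : ℕ}
    (p : ContinuousMultilinearMap 𝕜 (fun _ : Fin (n + 1) => E) F) (φ : E →L[𝕜] 𝕜) (e : E) {M : ℝ}
    (hM : 1 ≤ M) (hA : ‖ContinuousLinearMap.id 𝕜 E - φ.smulRight e‖ ≤ M) :
    ∃ q : ContinuousMultilinearMap 𝕜 (fun _ : Fin n => E) F,
      ‖q‖ ≤ (n + 1) * (‖p‖ * ‖e‖ * M ^ n) ∧
      ∀ x, p (fun _ => x) - p (fun _ => x - φ x • e) = φ x • q (fun _ => x) := by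
  set A := ContinuousLinearMap.id 𝕜 E - φ.smulRight e with hAdef
  -- The slots are changed from `x` to `A x` one at a time. The `k`-th difference has `x - A x = φ x
  -- • e` in slot `k`, `A x` in the slots before it and `x` in those after it.
  let B : Fin (n + 1) → Fin n → E →L[𝕜] E := fun k i =>
    if (i.castSucc : Fin (n + 1)) < k then A else ContinuousLinearMap.id 𝕜 E
  have hB : ∀ k i, ‖B k i‖ ≤ M := by
    intro k i
    dsimp only [B]
    split_ifs
    · exact hA
    · exact ContinuousLinearMap.norm_id_le.trans hM
  refine ⟨∑ k : Fin (n + 1), (p.curryMid k e).compContinuousLinearMap (B k), ?_, ?_⟩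
  · refine (norm_sum_le _ _).trans ?_
    have : ∀ k ∈ (Finset.univ : Finset (Fin (n + 1))),
        ‖(p.curryMid k e).compContinuousLinearMap (B k)‖ ≤ ‖p‖ * ‖e‖ * M ^ n := by
      intro k _
      refine (ContinuousMultilinearMap.norm_compContinuousLinearMap_le _ _).trans ?_
      have h1 : ‖p.curryMid k e‖ ≤ ‖p‖ * ‖e‖ := by
        simpa using (p.curryMid k).le_opNorm e
      have h2 : ∏ i, ‖B k i‖ ≤ M ^ n := by
        refine (Finset.prod_le_prod (fun _ _ => norm_nonneg _) fun i _ => hB k i).trans ?_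
        simp
      gcongr
    refine (Finset.sum_le_card_nsmul _ _ _ this).trans ?_
    simp
  · intro x
    let v : ℕ → Fin (n + 1) → E := fun k i => if (i : ℕ) < k then x - φ x • e else x
    have hstep : ∀ k : Fin (n + 1), p (v k) - p (v (k + 1))
        = φ x • (p.curryMid k e).compContinuousLinearMap (B k) (fun _ => x) := by
      intro k
      have e1 : v k = Function.update (v k) k x := by
        rw [eq_comm, Function.update_eq_self_iff]; simp [v]
      have e2 : v (k + 1) = Function.update (v k) k (x - φ x • e) := by
        ext i
        rcases lt_trichotomy i k with h | h | h
        · have h' : (i : ℕ) < k := h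
          rw [Function.update_of_ne h.ne]
          simp only [v, if_pos h', if_pos (Nat.lt_succ_of_lt h')]
        · subst h; simp [v]
        · have h' : (k : ℕ) < i := h
          rw [Function.update_of_ne h.ne']
          simp only [v, if_neg h'.not_gt, if_neg (show ¬ ((i : ℕ) < k + 1) by omega)]
      have e3 : (p.curryMid k e).compContinuousLinearMap (B k) (fun _ => x)
          = p (Function.update (v k) k e) := by
        rw [ContinuousMultilinearMap.compContinuousLinearMap_apply,
          ContinuousMultilinearMap.curryMid_apply]
        congr 1
        rw [Fin.insertNth_eq_iff]
        refine ⟨by simp, ?_⟩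
        ext i
        simp only [Fin.removeNth, B, v]
        rw [Function.update_of_ne (Fin.succAbove_ne k i)]
        by_cases h : i.castSucc < k
        · rw [Fin.succAbove_of_castSucc_lt _ _ h]
          have h' : (i : ℕ) < k := h
          simp [h, h', hAdef]
        · rw [Fin.succAbove_of_le_castSucc _ _ (not_lt.1 h)]
          have h' : (k : ℕ) ≤ i := not_lt.1 h
          simp [h, show ¬ ((i : ℕ) + 1 < k) by omega]
      rw [e3, e2, ← p.map_update_smul]
      nth_rewrite 1 [e1]
      rw [← p.map_update_sub]
      rw [sub_sub_cancel]
    rw [_root_.sum_apply, Finset.smul_sum, ← Finset.sum_congr rfl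
      (fun k _ => hstep k), Fin.sum_univ_eq_sum_range (fun k => p (v k) - p (v (k + 1))) (n + 1),
      Finset.sum_range_sub']
    congr 2
    ext i
    simp [v, i.isLt]

/-- Division of an analytic function by a linear form. -/
theorem AnalyticAt.exists_eq_add_smul [CompleteSpace F] {f : E → F} (hf : AnalyticAt 𝕜 f 0)
    (φ : E →L[𝕜] 𝕜) (e : E) :
    ∃ g : E → F, AnalyticAt 𝕜 g 0 ∧ ∀ᶠ x in 𝓝 (0 : E), f x = f (x - φ x • e) + φ x • g x := by
  obtain ⟨p, C, r, hr, hp, hs⟩ := analyticAt_zero_iff_hasSum.1 hf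
  set M := max 1 ‖ContinuousLinearMap.id 𝕜 E - φ.smulRight e‖ with hM
  choose q hq1 hq2 using fun n => (p (n + 1)).exists_sub_eq_smul φ e (hM ▸ le_max_left _ _ : 1 ≤ M)
    (hM ▸ le_max_right _ _)
  have hC : 0 ≤ C := by
    have := (norm_nonneg _).trans (hp 0)
    simpa using this
  have hM1 : 1 ≤ M := le_max_left _ _
  have hbound : ∀ n, ‖q n‖ ≤ (C * r * ‖e‖) * (2 * r * M) ^ n := by
    intro n
    -- The `n + 1` telescoping terms cost only a factor 2 in the geometric rate.
    have h2 : ((n : ℝ) + 1) ≤ 2 ^ n := by exact_mod_cast Nat.lt_two_pow_self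
    calc ‖q n‖ ≤ (n + 1) * (‖p (n + 1)‖ * ‖e‖ * M ^ n) := hq1 n
      _ ≤ 2 ^ n * (C * r ^ (n + 1) * ‖e‖ * M ^ n) := by
        gcongr
        exact hp (n + 1)
      _ = (C * r * ‖e‖) * (2 * r * M) ^ n := by rw [mul_pow, mul_pow]; ring
  obtain ⟨hg, hgs⟩ := FormalMultilinearSeries.analyticAt_sum q (by positivity) hbound
  refine ⟨_, hg, ?_⟩
  have hA : Tendsto (fun x => x - φ x • e) (𝓝 (0 : E)) (𝓝 0) := by
    have : Continuous fun x => x - φ x • e := by fun_prop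
    simpa using this.tendsto 0
  filter_upwards [hs, hA.eventually hs, hgs] with x h1 h2 h3
  have h4 := h1.sub h2
  have h5 := h3.const_smul (φ x)
  have h6 : (fun n => φ x • q n fun _ => x)
      = fun n => p (n + 1) (fun _ => x) - p (n + 1) (fun _ => x - φ x • e) := by
    ext n; exact (hq2 n x).symm
  -- The terms of degree 0 cancel, so the difference series starts in degree 1 and its degree `n +
  -- 1` term yields the degree `n` term of the quotient.
  have h7 := (hasSum_nat_add_iff' 1).2 h4
  rw [← sub_eq_iff_eq_add']
  refine (h7.unique (h6 ▸ h5) ▸ ?_)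
  have : p 0 (fun _ => x) = p 0 (fun _ => x - φ x • e) := congrArg _ (Subsingleton.elim _ _)
  simp [this]

end PowerSeries

/-! ### Conjugation of holomorphic functions -/

section Star

variable {E : Type*} [NormedAddCommGroup E] [NormedSpace ℂ E] [StarAddMonoid E]
  [NormedStarGroup E] [StarModule ℂ E]
  {F : Type*} [NormedAddCommGroup F] [NormedSpace ℂ F] [StarAddMonoid F]
  [NormedStarGroup F] [StarModule ℂ F]

/-- Conjugating both the arguments and the value is antilinear twice, hence complex linear in each
slot. -/
lemma ContinuousMultilinearMap.exists_star_star {n : ℕ}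
    (p : ContinuousMultilinearMap ℂ (fun _ : Fin n => E) F) :
    ∃ q : ContinuousMultilinearMap ℂ (fun _ : Fin n => E) F, ‖q‖ ≤ ‖p‖ ∧
      ∀ v, q v = star (p fun i => star (v i)) := by
  have hu : ∀ [DecidableEq (Fin n)] (m : Fin n → E) (i : Fin n) (x : E),
      (fun j => star (Function.update m i x j))
        = Function.update (fun j => star (m j)) i (star x) := by
    intro _ m i x
    ext j
    by_cases h : j = i
    · subst h; simp
    · simp [h]
  let q : MultilinearMap ℂ (fun _ : Fin n => E) F :=
    { toFun := fun v => star (p fun i => star (v i))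
      map_update_add' := fun m i x y => by rw [hu, hu, hu]; simp
      map_update_smul' := fun m i c x => by rw [hu, hu]; simp }
  refine ⟨q.mkContinuous ‖p‖ ?_, q.mkContinuous_norm_le (norm_nonneg _) _, fun v => rfl⟩
  intro v
  change ‖star (p fun i => star (v i))‖ ≤ _
  rw [norm_star]
  simpa using p.le_opNorm fun i => star (v i)

/-- If `f` is complex analytic then so is `x ↦ star (f (star x))`. -/
theorem AnalyticAt.star_star {f : E → F} (hf : AnalyticAt ℂ f 0) :
    AnalyticAt ℂ (fun x => star (f (star x))) 0 := by
  obtain ⟨p, C, r, hr, hp, hs⟩ := analyticAt_zero_iff_hasSum.1 hf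
  choose q hq1 hq2 using fun n => (p n).exists_star_star
  refine analyticAt_zero_iff_hasSum.2 ⟨q, C, r, hr, fun n => (hq1 n).trans (hp n), ?_⟩
  have hA : Tendsto (fun x : E => star x) (𝓝 0) (𝓝 0) := by
    simpa using (continuous_star (R := E)).tendsto 0
  filter_upwards [hA.eventually hs] with x hx
  have : (fun n => q n fun _ => x) = fun n => star (p n fun _ => star x) := by
    ext n; exact hq2 n _
  rw [this]
  exact hx.star

end Star

/-! ### Complexification and polarization of real analytic functions -/

section Complexification

/-- The complex multilinear extension of a real multilinear form, with respect to complex linear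
coordinates `c i` which restrict to real coordinates on the image of `j`. -/
lemma ContinuousMultilinearMap.exists_complexification
    {E : Type*} [NormedAddCommGroup E] [NormedSpace ℝ E]
    {V : Type*} [NormedAddCommGroup V] [NormedSpace ℂ V] {ι : Type*} [Fintype ι] {n : ℕ}
    (p : ContinuousMultilinearMap ℝ (fun _ : Fin n => E) ℝ) (e : ι → E) (c : ι → V →L[ℂ] ℂ)
    (j : E → V) (r : ι → E → ℝ) (hr : ∀ x i, c i (j x) = r i x)
    (hx : ∀ x, ∑ i, r i x • e i = x) {a b : ℝ} (ha : ∀ i, ‖e i‖ ≤ a) (hb : ∀ i, ‖c i‖ ≤ b)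
    (ha0 : 0 ≤ a) :
    ∃ q : ContinuousMultilinearMap ℂ (fun _ : Fin n => V) ℂ,
      ‖q‖ ≤ ‖p‖ * (Fintype.card ι * (a * b)) ^ n ∧
      ∀ x, q (fun _ => j x) = (p (fun _ => x) : ℝ) := by
  classical
  have hsmul : ∀ (t : ℂ) (T : ContinuousMultilinearMap ℂ (fun _ : Fin n => V) ℂ),
      ‖t • T‖ ≤ ‖t‖ * ‖T‖ := fun t T => norm_smul_le t T
  -- Expand `p` in the spanning vectors `e i` and replace each real coordinate by its complex linear
  -- extension `c i`. The number of multi-indices is `card ι ^ n`, so the bound stays geometric.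
  refine ⟨∑ i : Fin n → ι, ((p fun k => e (i k) : ℝ) : ℂ) •
      (ContinuousMultilinearMap.mkPiAlgebraFin ℂ n ℂ).compContinuousLinearMap fun k => c (i k),
      ?_, ?_⟩
  · have key : ∀ i ∈ (Finset.univ : Finset (Fin n → ι)),
        ‖((p fun k => e (i k) : ℝ) : ℂ) •
          (ContinuousMultilinearMap.mkPiAlgebraFin ℂ n ℂ).compContinuousLinearMap
            fun k => c (i k)‖ ≤ (‖p‖ * a ^ n) * b ^ n := by
      intro i _
      have h1 : ‖((p fun k => e (i k) : ℝ) : ℂ)‖ ≤ ‖p‖ * a ^ n := by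
        rw [Complex.norm_real]
        refine (p.le_opNorm _).trans ?_
        gcongr
        refine (Finset.prod_le_prod (fun _ _ => norm_nonneg _) fun k _ => ha (i k)).trans ?_
        simp
      have h2 : ‖(ContinuousMultilinearMap.mkPiAlgebraFin ℂ n ℂ).compContinuousLinearMap
            fun k => c (i k)‖ ≤ b ^ n := by
        refine (ContinuousMultilinearMap.norm_compContinuousLinearMap_le _ _).trans ?_
        rw [ContinuousMultilinearMap.norm_mkPiAlgebraFin, one_mul]
        refine (Finset.prod_le_prod (fun _ _ => norm_nonneg _) fun k _ => hb (i k)).trans ?_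
        simp
      exact (hsmul _ _).trans (mul_le_mul h1 h2 (norm_nonneg _) (by positivity))
    refine (norm_sum_le _ _).trans ((Finset.sum_le_card_nsmul _ _ _ key).trans_eq ?_)
    rw [Finset.card_univ, Fintype.card_fun, Fintype.card_fin, nsmul_eq_mul, mul_pow, mul_pow]
    push_cast
    ring
  · intro x
    conv_rhs => rw [← hx x]
    rw [ContinuousMultilinearMap.map_sum]
    simp only [_root_.sum_apply, _root_.smul_apply,
      ContinuousMultilinearMap.compContinuousLinearMap_apply,
      ContinuousMultilinearMap.mkPiAlgebraFin_apply, hr]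
    rw [Complex.ofReal_sum]
    refine Finset.sum_congr rfl fun i _ => ?_
    rw [ContinuousMultilinearMap.map_smul_univ]
    simp [List.prod_ofFn, mul_comm]

/-- Complexification of a real analytic function, with respect to complex linear coordinates `c i`
which restrict to real coordinates on the image of `j`. -/
lemma AnalyticAt.exists_complexification {E : Type*} [NormedAddCommGroup E] [NormedSpace ℝ E]
    {V : Type*} [NormedAddCommGroup V] [NormedSpace ℂ V] {ι : Type*} [Fintype ι]
    {f : E → ℝ} (hf : AnalyticAt ℝ f 0) (e : ι → E) (c : ι → V →L[ℂ] ℂ) (j : E → V)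
    (hj : Tendsto j (𝓝 0) (𝓝 0)) (r : ι → E → ℝ) (hr : ∀ x i, c i (j x) = r i x)
    (hx : ∀ x, ∑ i, r i x • e i = x) :
    ∃ P : V → ℂ, AnalyticAt ℂ P 0 ∧ ∀ᶠ x in 𝓝 0, P (j x) = f x := by
  obtain ⟨p, C, R, hR, hp, hs⟩ := analyticAt_zero_iff_hasSum.1 hf
  have ha : ∀ i, ‖e i‖ ≤ ∑ i, ‖e i‖ := fun i =>
    Finset.single_le_sum (f := fun i => ‖e i‖) (fun _ _ => norm_nonneg _) (Finset.mem_univ i)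
  have hb : ∀ i, ‖c i‖ ≤ ∑ i, ‖c i‖ := fun i =>
    Finset.single_le_sum (f := fun i => ‖c i‖) (fun _ _ => norm_nonneg _) (Finset.mem_univ i)
  have ha0 : 0 ≤ ∑ i, ‖e i‖ := Finset.sum_nonneg fun _ _ => norm_nonneg _
  have hb0 : 0 ≤ ∑ i, ‖c i‖ := Finset.sum_nonneg fun _ _ => norm_nonneg _
  choose q hq1 hq2 using fun n =>
    (p n).exists_complexification e c j r hr hx ha hb ha0
  set D := (Fintype.card ι : ℝ) * ((∑ i, ‖e i‖) * ∑ i, ‖c i‖)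
  have hD : 0 ≤ D := by positivity
  have hC : 0 ≤ C := by
    have := (norm_nonneg _).trans (hp 0)
    simpa using this
  have hbound : ∀ n, ‖q n‖ ≤ C * (R * (D + 1)) ^ n := by
    intro n
    calc ‖q n‖ ≤ ‖p n‖ * D ^ n := hq1 n
      _ ≤ (C * R ^ n) * (D + 1) ^ n := by
        gcongr
        · exact hp n
        · linarith
      _ = _ := by rw [mul_pow]; ring
  obtain ⟨hg, hgs⟩ := FormalMultilinearSeries.analyticAt_sum q (by positivity) hbound
  refine ⟨_, hg, ?_⟩
  filter_upwards [hs, hj.eventually hgs] with x h1 h2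
  refine h2.unique ?_
  simp only [hq2]
  exact_mod_cast Complex.hasSum_ofReal.2 h1

/-- Every real analytic function near the origin of `ℂ²` is the restriction to the conjugate
diagonal of a holomorphic function satisfying the reality condition. -/
theorem AnalyticAt.exists_polarization {f : C2 → ℝ} (hf : AnalyticAt ℝ f 0) :
    ∃ P : C2 × C2 → ℂ, AnalyticAt ℂ P 0 ∧ (∀ᶠ p in 𝓝 0, P (p, star p) = f p) ∧
      ∀ x y, P (star y, star x) = star (P (x, y)) := by
  let f1 := ContinuousLinearMap.fst ℂ C2 C2
  let f2 := ContinuousLinearMap.snd ℂ C2 C2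
  let g1 := ContinuousLinearMap.fst ℂ ℂ ℂ
  let g2 := ContinuousLinearMap.snd ℂ ℂ ℂ
  obtain ⟨P, hP, hPf⟩ := hf.exists_complexification
    ![((1 : ℂ), (0 : ℂ)), (Complex.I, 0), (0, 1), (0, Complex.I)]
    ![(1 / 2 : ℂ) • (g1 ∘L (f1 + f2)), (1 / (2 * Complex.I) : ℂ) • (g1 ∘L (f1 - f2)),
      (1 / 2 : ℂ) • (g2 ∘L (f1 + f2)), (1 / (2 * Complex.I) : ℂ) • (g2 ∘L (f1 - f2))]
    (fun p => (p, star p))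
    (by
      have : Continuous fun p : C2 => (p, star p) := by fun_prop
      exact this.tendsto' _ _ (by simp))
    ![fun p => p.1.re, fun p => p.1.im, fun p => p.2.re, fun p => p.2.im]
    (by
      intro p i
      fin_cases i <;> simp [f1, f2, g1, g2, Complex.ext_iff] <;> ring)
    (by
      intro p
      simp [Fin.sum_univ_four])
  have hswap : AnalyticAt ℂ (fun x : C2 × C2 => star (P (star (x.2, x.1)))) 0 := by
    have h1 : AnalyticAt ℂ (fun x : C2 × C2 => (x.2, x.1)) 0 :=
      analyticAt_snd.prod analyticAt_fst
    exact AnalyticAt.fun_comp (g := fun x : C2 × C2 => star (P (star x))) hP.star_star h1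
  -- Averaging with the conjugate reflection forces the reality condition at every point. On the
  -- conjugate diagonal both summands equal the real number `f p`, so nothing changes there.
  refine ⟨fun x => (P x + star (P (star (x.2, x.1)))) / 2, ?_, ?_, ?_⟩
  · exact (hP.add hswap).div_const
  · filter_upwards [hPf] with p hp
    have : star ((star p, p) : C2 × C2) = (p, star p) := by
      ext <;> simp
    simp only [this, hp]
    simp
  · intro x y
    have h1 : star ((star x, star y) : C2 × C2) = (x, y) := by
      ext <;> simp
    have h2 : ((star y, star x) : C2 × C2) = star (y, x) := rfl
    simp only [h1, h2, star_div₀, star_add]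
    rw [add_comm]
    simp

end Complexification

/-! ### Analytic implicit functions -/

/-- The analytic implicit function theorem for a scalar unknown, with local uniqueness. -/
theorem AnalyticAt.exists_implicit {𝕜 : Type*} [RCLike 𝕜] {E : Type*} [NormedAddCommGroup E]
    [NormedSpace 𝕜 E] [CompleteSpace E] {f : E × 𝕜 → 𝕜} {x₀ : E} {t₀ d : 𝕜}
    (hf : AnalyticAt 𝕜 f (x₀, t₀)) (h0 : f (x₀, t₀) = 0)
    (hd : HasDerivAt (fun t => f (x₀, t)) d t₀) (hd0 : d ≠ 0) :
    ∃ g : E → 𝕜, AnalyticAt 𝕜 g x₀ ∧ g x₀ = t₀ ∧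
      ∀ᶠ v in 𝓝 (x₀, t₀), f v = 0 ↔ g v.1 = v.2 := by
  -- The exponent `⊤` is the analytic class, so the implicit function is itself analytic.
  have hc : ContDiffAt 𝕜 ⊤ f (x₀, t₀) := hf.contDiffAt
  have hinv : (fderiv 𝕜 f (x₀, t₀) ∘L .inr 𝕜 E 𝕜).IsInvertible := by
    refine ⟨ContinuousLinearEquiv.unitsEquivAut 𝕜 (Units.mk0 d hd0), ?_⟩
    have h1 : HasFDerivAt (fun t : 𝕜 => f (x₀, t)) (fderiv 𝕜 f (x₀, t₀) ∘L .inr 𝕜 E 𝕜) t₀ :=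
      HasFDerivAt.comp t₀ hf.differentiableAt.hasFDerivAt (hasFDerivAt_prodMk_right x₀ t₀)
    have h2 := hd.hasFDerivAt.unique h1
    rw [← h2]
    ext
    simp
  refine ⟨hc.implicitFunction (by simp) hinv, ?_, hc.implicitFunction_apply_self _ hinv, ?_⟩
  · exact (hc.contDiffAt_implicitFunction (by simp) hinv).analyticAt
  · simpa only [h0] using hc.eventually_apply_eq_iff_implicitFunction (by simp) hinv

/-! ### Segre varieties and normal coordinates -/

section NormalCoordinates

lemma tendsto_star_zero {E : Type*} [NormedAddCommGroup E] [StarAddMonoid E]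
    [NormedStarGroup E] : Tendsto (fun x : E => star x) (𝓝 0) (𝓝 0) :=
  continuous_star.tendsto' _ _ (star_zero _)

/-- The differential of a polarization of a function with differential `c · Im w`. -/
lemma fderiv_polarization {ρ : C2 → ℝ} {c : ℝ} (hρ : DifferentiableAt ℝ ρ 0)
    (hd : ∀ p, fderiv ℝ ρ 0 p = c * p.2.im) {P : C2 × C2 → ℂ} (hP : AnalyticAt ℂ P 0)
    (hPρ : ∀ᶠ p in 𝓝 0, P (p, star p) = ρ p) (x : C2 × C2) :
    fderiv ℂ P 0 x = c * (x.1.2 - x.2.2) / (2 * Complex.I) := by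
  set D := fderiv ℂ P 0 with hD
  have hDP : HasFDerivAt P D 0 := hP.differentiableAt.hasFDerivAt
  have key : ∀ a : C2, D (a, star a) = ((c * a.2.im : ℝ) : ℂ) := by
    intro a
    have hl : HasDerivAt (fun t : ℝ => t • ((a, star a) : C2 × C2)) (a, star a) 0 := by
      simpa using (hasDerivAt_id (0 : ℝ)).smul_const ((a, star a) : C2 × C2)
    have hl2 : HasDerivAt (fun t : ℝ => t • a) a 0 := by
      simpa using (hasDerivAt_id (0 : ℝ)).smul_const a
    have h1 : HasDerivAt (fun t : ℝ => P (t • ((a, star a) : C2 × C2))) (D (a, star a)) 0 := by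
      have := HasFDerivAt.comp_hasDerivAt_of_eq (𝕜 := ℝ) (0 : ℝ) (hDP.restrictScalars ℝ) hl
        (by simp)
      exact this
    have h2 : HasDerivAt (fun t : ℝ => ((ρ (t • a) : ℝ) : ℂ)) ((c * a.2.im : ℝ) : ℂ) 0 := by
      rw [← hd]
      exact (HasFDerivAt.comp_hasDerivAt_of_eq (0 : ℝ) hρ.hasFDerivAt hl2 (by simp)).ofReal_comp
    have h3 : (fun t : ℝ => P (t • ((a, star a) : C2 × C2))) =ᶠ[𝓝 0]
        fun t : ℝ => ((ρ (t • a) : ℝ) : ℂ) := by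
      have ht : Tendsto (fun t : ℝ => t • a) (𝓝 0) (𝓝 0) := by
        simpa using hl2.continuousAt.tendsto
      filter_upwards [ht.eventually hPρ] with t h
      rw [← h]
      congr 1
      ext <;> simp
    exact h1.unique (h2.congr_of_eventuallyEq h3)
  obtain ⟨p, q⟩ := x
  -- The conjugate diagonal is totally real and spans: every vector is `(a, ā) + i (b, b̄)`. The
  -- complex linear map `D` is thus determined by `key`.
  have hdec : ((p, q) : C2 × C2)
      = (((1 / 2 : ℂ) • (p + star q), star ((1 / 2 : ℂ) • (p + star q))) : C2 × C2)
      + Complex.I • (((1 / (2 * Complex.I) : ℂ) • (p - star q),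
          star ((1 / (2 * Complex.I) : ℂ) • (p - star q))) : C2 × C2) := by
    ext <;> simp <;> field_simp <;> ring_nf <;> simp <;> ring
  rw [hdec, map_add, map_smul, key, key]
  have h1 : ((1 / 2 : ℂ) • (p + star q)).2.im = (p.2.im - q.2.im) / 2 := by
    simp; ring
  have h2 : ((1 / (2 * Complex.I) : ℂ) • (p - star q)).2.im = -(p.2.re - q.2.re) / 2 := by
    simp; ring
  rw [h1, h2, div_mul_eq_div_div, Complex.div_I]
  apply Complex.ext <;> simp <;> ring

/-- The Segre function: the holomorphic solution of `P (p, (0, s)) = 0` for `s`. -/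
lemma exists_segre {P : C2 × C2 → ℂ} {c : ℝ} (hc : c ≠ 0) (hP : AnalyticAt ℂ P 0) (hP0 : P 0 = 0)
    (hdP : ∀ x, fderiv ℂ P 0 x = c * (x.1.2 - x.2.2) / (2 * Complex.I)) :
    ∃ S : C2 → ℂ, AnalyticAt ℂ S 0 ∧ S 0 = 0 ∧ (∀ p, fderiv ℂ S 0 p = p.2) ∧
      (∀ᶠ p in 𝓝 0, P (p, (0, S p)) = 0) ∧
      ∀ᶠ v : C2 × ℂ in 𝓝 0, P (v.1, (0, v.2)) = 0 ↔ S v.1 = v.2 := by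
  have hDP : HasFDerivAt P (fderiv ℂ P 0) ((0 : C2), ((0 : ℂ), (0 : ℂ))) :=
    hP.differentiableAt.hasFDerivAt
  have hf : AnalyticAt ℂ (fun v : C2 × ℂ => P (v.1, (0, v.2))) ((0 : C2), (0 : ℂ)) :=
    AnalyticAt.fun_comp (g := P) (f := fun v : C2 × ℂ => (v.1, ((0 : ℂ), v.2))) hP
      (analyticAt_fst.prod (analyticAt_const.prod analyticAt_snd))
  have hd : HasDerivAt (fun t : ℂ => P (0, (0, t))) (fderiv ℂ P 0 (0, (0, 1))) 0 :=
    HasFDerivAt.comp_hasDerivAt (0 : ℂ) hDP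
      ((hasDerivAt_const _ _).prodMk ((hasDerivAt_const _ _).prodMk (hasDerivAt_id _)))
  obtain ⟨S, hS, hS0, hiff⟩ := hf.exists_implicit hP0 hd (by rw [hdP]; simp [hc])
  have hSd : HasFDerivAt S (fderiv ℂ S 0) 0 := hS.differentiableAt.hasFDerivAt
  have hev : ∀ᶠ p in 𝓝 0, P (p, (0, S p)) = 0 := by
    have ht : Tendsto (fun p : C2 => (p, S p)) (𝓝 0) (𝓝 ((0 : C2), (0 : ℂ))) := by
      have := (continuousAt_id (x := (0 : C2))).prodMk hS.continuousAt
      simpa [ContinuousAt, hS0] using this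
    filter_upwards [ht.eventually hiff] with p hp
    exact hp.2 rfl
  refine ⟨S, hS, hS0, fun p => ?_, hev, hiff⟩
  have h1 : HasFDerivAt (fun p => P (p, (0, S p))) (fderiv ℂ P 0 ∘L
      (ContinuousLinearMap.id ℂ C2).prod ((0 : C2 →L[ℂ] ℂ).prod (fderiv ℂ S 0))) 0 :=
    HasFDerivAt.comp (0 : C2) (by rw [hS0]; exact hDP)
      ((hasFDerivAt_id _).prodMk ((hasFDerivAt_const _ _).prodMk hSd))
  have h2 := (h1.congr_of_eventuallyEq (f₁ := fun _ => (0 : ℂ))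
    (by filter_upwards [hev] with p hp using hp.symm)).unique (hasFDerivAt_const _ _)
  have h3 := congrArg (fun l => l p) h2
  simp [hdP, hc, sub_eq_zero] at h3
  exact h3.symm

/-- Biholomorphism built from the Segre function, in which the polarized function vanishes
for `z = 0`, `w = τ`, and for `χ = 0`, `w = τ`. -/
lemma exists_normal_polarization {ρ : C2 → ℝ} {c : ℝ} (hc : c ≠ 0) (hρ : AnalyticAt ℝ ρ 0)
    (hρ0 : ρ 0 = 0) (hd : ∀ p, fderiv ℝ ρ 0 p = c * p.2.im) :
    ∃ (Φ : OpenPartialHomeomorph C2 C2) (P : C2 × C2 → ℂ),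
      (0 : C2) ∈ Φ.source ∧ Φ 0 = 0 ∧ AnalyticAt ℂ Φ 0 ∧ AnalyticAt ℂ Φ.symm 0 ∧
      HasFDerivAt Φ.symm (ContinuousLinearMap.id ℂ C2) 0 ∧ AnalyticAt ℂ P 0 ∧
      (∀ᶠ p in 𝓝 0, P (p, star p) = ρ p) ∧
      (∀ᶠ q : C2 in 𝓝 0, P (Φ.symm q, star (Φ.symm (star (0, q.2)))) = 0) ∧
      (∀ᶠ q : C2 in 𝓝 0, P (Φ.symm (0, q.2), star (Φ.symm (star q))) = 0) := by
  obtain ⟨P, hP, hPρ, hPs⟩ := hρ.exists_polarization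
  have hP0 : P 0 = 0 := by
    have := hPρ.self_of_nhds
    rw [hρ0, star_zero] at this
    exact this
  have hdP := fderiv_polarization hρ.differentiableAt hd hP hPρ
  obtain ⟨S, hS, hS0, hdS, hS1, hS2⟩ := exists_segre hc hP hP0 hdP
  have hSd : HasStrictFDerivAt S (fderiv ℂ S 0) 0 := hS.hasStrictFDerivAt
  let T : C2 → ℂ := fun p => star (S (star p))
  have hT : AnalyticAt ℂ T 0 := hS.star_star
  have hT0 : T 0 = 0 := by simp [T, hS0]
  have hTd : HasStrictFDerivAt T (fderiv ℂ T 0) 0 := hT.hasStrictFDerivAt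
  have hdT : ∀ p, fderiv ℂ T 0 p = p.2 := by
    intro p
    have hev : ∀ᶠ p in 𝓝 0, P ((0, T p), p) = 0 := by
      filter_upwards [tendsto_star_zero.eventually hS1] with p hp
      have := hPs (star p) (0, S (star p))
      rw [hp] at this
      simpa [T, Prod.star_def] using this
    have h1 : HasFDerivAt (fun p => P ((0, T p), p)) (fderiv ℂ P 0 ∘L
        ((0 : C2 →L[ℂ] ℂ).prod (fderiv ℂ T 0)).prod (ContinuousLinearMap.id ℂ C2)) 0 :=
      HasFDerivAt.comp (0 : C2) (by rw [hT0]; exact hP.differentiableAt.hasFDerivAt)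
        (((hasFDerivAt_const _ _).prodMk hTd.hasFDerivAt).prodMk (hasFDerivAt_id _))
    have h2 := (h1.congr_of_eventuallyEq (f₁ := fun _ => (0 : ℂ))
      (by filter_upwards [hev] with p hp using hp.symm)).unique (hasFDerivAt_const _ _)
    have h3 := congrArg (fun l => l p) h2
    simp [hdP, hc, sub_eq_zero] at h3
    exact h3
  -- `S` alone would straighten the Segre varieties of the `w`-axis. Averaging with its reflection
  -- makes the labels compatible with conjugation, and the factor 1/2 keeps the differential equal
  -- to the identity.
  let G : C2 → C2 := fun p => (p.1, (1 / 2 : ℂ) * (S p + T (0, S p)))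
  have hTS : AnalyticAt ℂ (fun p => T (0, S p)) 0 :=
    AnalyticAt.fun_comp (g := T) (f := fun p : C2 => ((0 : ℂ), S p)) (by rw [hS0]; exact hT)
      (analyticAt_const.prod hS)
  have hG : AnalyticAt ℂ G 0 := analyticAt_fst.prod (analyticAt_const.mul (hS.add hTS))
  have hG0 : G 0 = 0 := by
    have : T (0, 0) = 0 := hT0
    simp [G, hS0, this]
  have hGd : HasStrictFDerivAt G ((ContinuousLinearEquiv.refl ℂ C2 : C2 ≃L[ℂ] C2) : C2 →L[ℂ] C2)
      0 := by
    have h1 : HasStrictFDerivAt (fun p => T (0, S p)) (fderiv ℂ T 0 ∘L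
        (0 : C2 →L[ℂ] ℂ).prod (fderiv ℂ S 0)) 0 :=
      HasStrictFDerivAt.comp (0 : C2) (by rw [hS0]; exact hTd)
        ((hasStrictFDerivAt_const _ _).prodMk hSd)
    have h2 := (hasStrictFDerivAt_fst (𝕜 := ℂ) (p := (0 : C2))).prodMk
      ((hSd.add h1).const_mul (1 / 2 : ℂ))
    refine h2.congr_fderiv ?_
    ext <;> (simp [hdS, hdT]; try norm_num)
  let Φ := hGd.toOpenPartialHomeomorph G
  have hΦG : ∀ p, Φ p = G p := fun p => rfl
  have hsrc : (0 : C2) ∈ Φ.source := hGd.mem_toOpenPartialHomeomorph_source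
  have hΦ0 : Φ 0 = 0 := hG0
  have htgt : (0 : C2) ∈ Φ.target := by rw [← hΦ0]; exact Φ.map_source hsrc
  have hΨ0 : Φ.symm 0 = 0 := by
    conv_lhs => rw [← hΦ0]
    exact Φ.left_inv hsrc
  have hΨ : AnalyticAt ℂ Φ.symm 0 := by
    refine Φ.analyticAt_symm htgt ?_ (i := ContinuousLinearEquiv.refl ℂ C2) ?_
    · rw [hΨ0]; exact hG
    · rw [hΨ0]; exact hGd.hasFDerivAt.fderiv
  have hΨd : HasFDerivAt Φ.symm (ContinuousLinearMap.id ℂ C2) 0 := by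
    have := Φ.hasFDerivAt_symm (f' := ContinuousLinearEquiv.refl ℂ C2) htgt
      (by rw [hΨ0]; exact hGd.hasFDerivAt)
    exact this
  have tΨ : Tendsto Φ.symm (𝓝 0) (𝓝 0) := by
    have := hΨ.continuousAt.tendsto
    rwa [hΨ0] at this
  have tS : Tendsto S (𝓝 0) (𝓝 0) := by
    have := hS.continuousAt.tendsto
    rwa [hS0] at this
  have t0 : Tendsto (fun s : ℂ => ((0 : ℂ), s)) (𝓝 0) (𝓝 (0 : C2)) := by
    have : Continuous fun s : ℂ => ((0 : ℂ), s) := by fun_prop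
    exact this.tendsto' _ _ rfl
  -- Being on the Segre variety of another point is a symmetric relation, by reality. Hence the
  -- antiholomorphic reflection `s ↦ conj (S (0, s))` of the `w`-axis is an involution.
  have hinv : ∀ᶠ s : ℂ in 𝓝 0, S (0, star (S (0, star s))) = s := by
    have t1 : Tendsto (fun s : ℂ => ((0 : ℂ), star s)) (𝓝 0) (𝓝 (0 : C2)) := t0.comp tendsto_star_zero
    have t2 : Tendsto (fun s : ℂ => (((0 : ℂ), star (S (0, star s))), s)) (𝓝 0)
        (𝓝 (0 : C2 × ℂ)) :=
      (t0.comp (tendsto_star_zero.comp (tS.comp t1))).prodMk_nhds tendsto_id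
    filter_upwards [t1.eventually hS1, t2.eventually hS2] with s h1 h2
    refine h2.1 ?_
    have := hPs (0, star s) (0, S (0, star s))
    rw [h1] at this
    simpa [Prod.star_def] using this
  have hmain : ∀ᶠ q : C2 in 𝓝 0, P (Φ.symm q, star (Φ.symm (star (0, q.2)))) = 0 := by
    have tSΨ : Tendsto (fun q => S (Φ.symm q)) (𝓝 0) (𝓝 0) := tS.comp tΨ
    have t3 : Tendsto (fun q => ((0 : ℂ), star (S (Φ.symm q)))) (𝓝 0) (𝓝 (0 : C2)) :=
      t0.comp (tendsto_star_zero.comp tSΨ)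
    filter_upwards [Φ.eventually_right_inverse htgt, t3.eventually (Φ.eventually_left_inverse hsrc),
      tΨ.eventually hS1, tSΨ.eventually hinv] with q hq1 hq2 hq3 hq4
    set p := Φ.symm q with hp
    have hu : q.2 = (1 / 2 : ℂ) * (S p + T (0, S p)) := by
      rw [← hq1]; rfl
    -- The axis point whose Segre variety contains `p` has second coordinate conjugate to that of
    -- `p`: the reflection exchanges the two summands of `G`, up to conjugation.
    have h1 : Φ (0, star (S p)) = star (0, q.2) := by
      rw [hΦG, hu]
      have e1 : T (0, S p) = star (S (0, star (S p))) := by simp [T, Prod.star_def]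
      have e2 : T (0, S (0, star (S p))) = star (S p) := by
        conv_rhs => rw [← hq4]
        simp [T, Prod.star_def]
      simp only [G, e1, e2]
      ext <;> simp [add_comm]
    rw [← h1, hq2]
    simpa [Prod.star_def] using hq3
  refine ⟨Φ, P, hsrc, hΦ0, hG, hΨ, hΨd, hP, hPρ, hmain, ?_⟩
  filter_upwards [tendsto_star_zero.eventually hmain] with q hq
  have := hPs (Φ.symm (star q)) (star (Φ.symm (star (0, (star q).2))))
  rw [hq] at this
  simpa [Prod.star_def] using this

end NormalCoordinates

/-! ### Divisibility by `z * χ` and the normal form of the defining function -/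

/-- Division by `z * χ` of a holomorphic function of `((z, χ), u)` vanishing on both divisors. -/
lemma AnalyticAt.exists_eq_mul_mul {H : (ℂ × ℂ) × ℂ → ℂ} (hH : AnalyticAt ℂ H 0)
    (h1 : ∀ᶠ q : ℂ × ℂ in 𝓝 0, H ((q.1, 0), q.2) = 0)
    (h2 : ∀ᶠ q : ℂ × ℂ in 𝓝 0, H ((0, q.1), q.2) = 0) :
    ∃ g : (ℂ × ℂ) × ℂ → ℂ, AnalyticAt ℂ g 0 ∧
      ∀ᶠ x : (ℂ × ℂ) × ℂ in 𝓝 0, H x = x.1.1 * x.1.2 * g x := by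
  obtain ⟨g₁, hg₁, hd₁⟩ := hH.exists_eq_add_smul
    (ContinuousLinearMap.fst ℂ ℂ ℂ ∘L ContinuousLinearMap.fst ℂ (ℂ × ℂ) ℂ) ((1, 0), 0)
  obtain ⟨g₂, hg₂, hd₂⟩ := hg₁.exists_eq_add_smul
    (ContinuousLinearMap.snd ℂ ℂ ℂ ∘L ContinuousLinearMap.fst ℂ (ℂ × ℂ) ℂ) ((0, 1), 0)
  refine ⟨g₂, hg₂, ?_⟩
  have t1 : Tendsto (fun x : (ℂ × ℂ) × ℂ => (x.1.1, x.2)) (𝓝 0) (𝓝 (0 : ℂ × ℂ)) :=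
    Continuous.tendsto' (by fun_prop) _ _ rfl
  have t2 : Tendsto (fun x : (ℂ × ℂ) × ℂ => (x.1.2, x.2)) (𝓝 0) (𝓝 (0 : ℂ × ℂ)) :=
    Continuous.tendsto' (by fun_prop) _ _ rfl
  have t3 : Tendsto (fun x : (ℂ × ℂ) × ℂ => ((x.1.1, (0 : ℂ)), x.2)) (𝓝 0)
      (𝓝 (0 : (ℂ × ℂ) × ℂ)) := Continuous.tendsto' (by fun_prop) _ _ rfl
  have t4 : Tendsto (fun x : (ℂ × ℂ) × ℂ => (((0 : ℂ), (0 : ℂ)), x.2)) (𝓝 0)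
      (𝓝 (0 : (ℂ × ℂ) × ℂ)) := Continuous.tendsto' (by fun_prop) _ _ rfl
  have t5 : Tendsto (fun x : (ℂ × ℂ) × ℂ => ((0 : ℂ), x.2)) (𝓝 0) (𝓝 (0 : ℂ × ℂ)) :=
    Continuous.tendsto' (by fun_prop) _ _ rfl
  filter_upwards [t1.eventually h1, t2.eventually h2, hd₁, t3.eventually hd₁, hd₂,
    t5.eventually h2] with x e1 e2 e3 e4 e5 e6
  simp only [ContinuousLinearMap.comp_apply, ContinuousLinearMap.coe_fst',
    ContinuousLinearMap.coe_snd', smul_eq_mul] at e3 e4 e5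
  have s1 : x - x.1.1 • (((1 : ℂ), (0 : ℂ)), (0 : ℂ)) = ((0, x.1.2), x.2) := by ext <;> simp
  have s2 : (((x.1.1, (0 : ℂ)), x.2) : (ℂ × ℂ) × ℂ) - x.1.1 • (((1 : ℂ), (0 : ℂ)), (0 : ℂ))
      = ((0, 0), x.2) := by ext <;> simp
  have s3 : x - x.1.2 • (((0 : ℂ), (1 : ℂ)), (0 : ℂ)) = ((x.1.1, 0), x.2) := by ext <;> simp
  rw [s1, e2, zero_add] at e3
  rw [s2, e1, e6, zero_add] at e4
  rw [s3] at e5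
  -- The remainder `g₁ ((z, 0), u)` is controlled only after multiplication by `z`, which is all
  -- that is needed; no division at `z = 0` occurs.
  rw [e3, e5, mul_add, ← e4]
  ring

/-- Holomorphic coordinates in which a real analytic function with differential `c · Im w` is
divisible by `z \bar z` modulo `v`. -/
theorem exists_normal_coordinates {ρ : C2 → ℝ} {c : ℝ} (hc : c ≠ 0) (hρ : AnalyticAt ℝ ρ 0)
    (hρ0 : ρ 0 = 0) (hd : ∀ p, fderiv ℝ ρ 0 p = c * p.2.im) :
    ∃ (Φ : OpenPartialHomeomorph C2 C2) (K : ℂ × ℝ → ℝ) (L : (ℂ × ℝ) × ℝ → ℝ),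
      (0 : C2) ∈ Φ.source ∧ Φ 0 = 0 ∧ AnalyticAt ℂ Φ 0 ∧ AnalyticAt ℂ Φ.symm 0 ∧
      HasFDerivAt Φ.symm (ContinuousLinearMap.id ℂ C2) 0 ∧
      AnalyticAt ℝ K 0 ∧ AnalyticAt ℝ L 0 ∧
      ∀ᶠ x : (ℂ × ℝ) × ℝ in 𝓝 0, ρ (Φ.symm (x.1.1, x.1.2 + x.2 * Complex.I))
        = Complex.normSq x.1.1 * K x.1 + x.2 * L x := by
  obtain ⟨Φ, P, hsrc, hΦ0, hΦ, hΨ, hΨd, hP, hPρ, hz, hχ⟩ := exists_normal_polarization hc hρ hρ0 hd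
  have hΨ0 : Φ.symm 0 = 0 := by
    conv_lhs => rw [← hΦ0]
    exact Φ.left_inv hsrc
  have hP0 : AnalyticAt ℂ P (Φ.symm 0, star (Φ.symm (star 0))) := by
    rw [star_zero, hΨ0, star_zero]; exact hP
  let l₁ : (((ℂ × ℂ) × ℂ) × ℂ) → C2 := fun y => (y.1.1.1, y.1.2 + y.2 * Complex.I)
  let l₂ : (((ℂ × ℂ) × ℂ) × ℂ) → C2 := fun y => (y.1.1.2, y.1.2 - y.2 * Complex.I)
  -- Here `z`, `χ`, `u`, `v` are independent complex variables; `v = 0` is exactly the locus `w =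
  -- τ`.
  let H : (((ℂ × ℂ) × ℂ) × ℂ) → ℂ := fun y => P (Φ.symm (l₁ y), star (Φ.symm (star (l₂ y))))
  have a1 : AnalyticAt ℂ (fun y : ((ℂ × ℂ) × ℂ) × ℂ => y.1) 0 := analyticAt_fst
  have a2 : AnalyticAt ℂ (fun y : ((ℂ × ℂ) × ℂ) × ℂ => y.2) 0 := analyticAt_snd
  have a11 : AnalyticAt ℂ (fun y : ((ℂ × ℂ) × ℂ) × ℂ => y.1.1) 0 :=
    AnalyticAt.fun_comp (g := fun x : (ℂ × ℂ) × ℂ => x.1) analyticAt_fst a1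
  have a12 : AnalyticAt ℂ (fun y : ((ℂ × ℂ) × ℂ) × ℂ => y.1.2) 0 :=
    AnalyticAt.fun_comp (g := fun x : (ℂ × ℂ) × ℂ => x.2) analyticAt_snd a1
  have a111 : AnalyticAt ℂ (fun y : ((ℂ × ℂ) × ℂ) × ℂ => y.1.1.1) 0 :=
    AnalyticAt.fun_comp (g := fun x : ℂ × ℂ => x.1) analyticAt_fst a11
  have a112 : AnalyticAt ℂ (fun y : ((ℂ × ℂ) × ℂ) × ℂ => y.1.1.2) 0 :=
    AnalyticAt.fun_comp (g := fun x : ℂ × ℂ => x.2) analyticAt_snd a11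
  have hl₁ : AnalyticAt ℂ l₁ 0 := a111.prod (a12.add (a2.mul analyticAt_const))
  have hl₂ : AnalyticAt ℂ l₂ 0 := a112.prod (a12.sub (a2.mul analyticAt_const))
  have hl₁0 : l₁ 0 = 0 := by simp [l₁]
  have hl₂0 : l₂ 0 = 0 := by simp [l₂]
  have hH : AnalyticAt ℂ H 0 := by
    refine AnalyticAt.fun_comp (g := P)
      (f := fun y => (Φ.symm (l₁ y), star (Φ.symm (star (l₂ y))))) ?_ (AnalyticAt.prod ?_ ?_)
    · rw [hl₁0, hl₂0]; exact hP0
    · exact AnalyticAt.fun_comp (g := Φ.symm) (by rw [hl₁0]; exact hΨ) hl₁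
    · exact AnalyticAt.fun_comp (g := fun q => star (Φ.symm (star q)))
        (by rw [hl₂0]; exact hΨ.star_star) hl₂
  obtain ⟨L, hL, hHL⟩ := hH.exists_eq_add_smul (ContinuousLinearMap.snd ℂ ((ℂ × ℂ) × ℂ) ℂ) (0, 1)
  have hH0 : AnalyticAt ℂ (fun x : (ℂ × ℂ) × ℂ => H (x, 0)) 0 :=
    AnalyticAt.fun_comp (g := H) (f := fun x : (ℂ × ℂ) × ℂ => (x, (0 : ℂ))) hH
      (analyticAt_id.prod analyticAt_const)
  obtain ⟨K, hK, hHK⟩ := hH0.exists_eq_mul_mul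
    (by filter_upwards [hz] with q hq using by simpa [H, l₁, l₂] using hq)
    (by filter_upwards [hχ] with q hq using by simpa [H, l₁, l₂] using hq)
  let j : (ℂ × ℝ) → (ℂ × ℂ) × ℂ := fun x => ((x.1, conj x.1), (x.2 : ℂ))
  let J : (ℂ × ℝ) × ℝ → ((ℂ × ℂ) × ℂ) × ℂ := fun x => (j x.1, (x.2 : ℂ))
  have hj0 : j 0 = 0 := by simp [j]
  have hJ0 : J 0 = 0 := by simp [J, hj0]
  have hj : AnalyticAt ℝ j 0 := by
    refine AnalyticAt.prod (AnalyticAt.prod analyticAt_fst ?_) ?_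
    · exact AnalyticAt.fun_comp (g := fun z : ℂ => conj z)
        (Complex.conjCLE.toContinuousLinearMap.analyticAt _) analyticAt_fst
    · exact AnalyticAt.fun_comp (g := fun u : ℝ => (u : ℂ))
        (Complex.ofRealCLM.analyticAt _) analyticAt_snd
  have hJ : AnalyticAt ℝ J 0 := by
    refine AnalyticAt.prod ?_ ?_
    · exact AnalyticAt.fun_comp (g := j) hj analyticAt_fst
    · exact AnalyticAt.fun_comp (g := fun u : ℝ => (u : ℂ))
        (Complex.ofRealCLM.analyticAt _) analyticAt_snd
  refine ⟨Φ, fun x => (K (j x)).re, fun x => (L (J x)).re, hsrc, hΦ0, hΦ, hΨ, hΨd, ?_, ?_, ?_⟩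
  · refine AnalyticAt.fun_comp (g := fun z : ℂ => z.re) (Complex.reCLM.analyticAt _) ?_
    refine AnalyticAt.fun_comp (g := K) ?_ hj
    rw [hj0]
    exact hK.restrictScalars
  · refine AnalyticAt.fun_comp (g := fun z : ℂ => z.re) (Complex.reCLM.analyticAt _) ?_
    refine AnalyticAt.fun_comp (g := L) ?_ hJ
    rw [hJ0]
    exact hL.restrictScalars
  · have tJ : Tendsto J (𝓝 0) (𝓝 0) := by simpa [ContinuousAt, hJ0] using hJ.continuousAt
    have tj : Tendsto (fun x : (ℂ × ℝ) × ℝ => j x.1) (𝓝 0) (𝓝 0) := by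
      have h1 : Tendsto j (𝓝 0) (𝓝 0) := by simpa [ContinuousAt, hj0] using hj.continuousAt
      exact h1.comp (continuous_fst.tendsto' _ _ rfl)
    have tΨ : Tendsto (fun x => Φ.symm (l₁ (J x))) (𝓝 0) (𝓝 0) := by
      have h1 : Tendsto Φ.symm (𝓝 0) (𝓝 0) := by simpa [ContinuousAt, hΨ0] using hΨ.continuousAt
      have h2 : Tendsto l₁ (𝓝 0) (𝓝 0) := by simpa [ContinuousAt, hl₁0] using hl₁.continuousAt
      exact h1.comp (h2.comp tJ)
    filter_upwards [tJ.eventually hHL, tj.eventually hHK, tΨ.eventually hPρ] with x e1 e2 e3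
    have s1 : J x - (ContinuousLinearMap.snd ℂ ((ℂ × ℂ) × ℂ) ℂ) (J x) • ((0, 1) : ((ℂ × ℂ) × ℂ) × ℂ)
        = (j x.1, 0) := by
      ext <;> simp [J]
    have s2 : star (l₂ (J x)) = l₁ (J x) := by
      ext <;> simp [l₁, l₂, J, j]
    have s3 : H (J x) = ρ (Φ.symm (l₁ (J x))) := by
      rw [← e3]
      simp only [H, s2]
    rw [s1, e2, s3] at e1
    -- `K` and `L` need not be real on the conjugate diagonal, but `ρ`, `|z|²` and `v` are, so real
    -- parts may be taken.
    have := congrArg Complex.re e1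
    simp only [Complex.ofReal_re, Complex.add_re, smul_eq_mul, ContinuousLinearMap.coe_snd'] at this
    refine this.trans ?_
    have s4 : (j x.1).1.1 * (j x.1).1.2 = ((Complex.normSq x.1.1 : ℝ) : ℂ) :=
      Complex.mul_conj _
    have s5 : (J x).2 = ((x.2 : ℝ) : ℂ) := rfl
    rw [s4, s5, Complex.re_ofReal_mul, Complex.re_ofReal_mul]

/-! ### The Levi form along holomorphic discs -/

/-- The Levi form of `ρ` at the origin, up to a factor 4. -/
noncomputable def leviForm (ρ : C2 → ℝ) (ξ : C2) : ℝ :=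
  fderiv ℝ (fderiv ℝ ρ) 0 ξ ξ + fderiv ℝ (fderiv ℝ ρ) 0 (Complex.I • ξ) (Complex.I • ξ)

lemma hasDerivAt_deriv_of_eq_sq_mul {g m : ℝ → ℝ} (hm : AnalyticAt ℝ m 0)
    (h : ∀ᶠ t in 𝓝 0, g t = t ^ 2 * m t) : HasDerivAt (deriv g) (2 * m 0) 0 := by
  have h1 : deriv g =ᶠ[𝓝 0] fun t => 2 * t * m t + t ^ 2 * deriv m t := by
    have h2 : g =ᶠ[𝓝 0] fun t => t ^ 2 * m t := h
    filter_upwards [h2.deriv, hm.eventually_analyticAt] with t e1 e2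
    rw [e1]
    have := (hasDerivAt_pow 2 t).mul e2.differentiableAt.hasDerivAt
    refine this.deriv.trans ?_
    simp
  refine HasDerivAt.congr_of_eventuallyEq ?_ h1
  have h3 := ((((hasDerivAt_id (0 : ℝ)).const_mul 2).mul hm.differentiableAt.hasDerivAt).add
    ((hasDerivAt_pow 2 (0 : ℝ)).mul hm.deriv.differentiableAt.hasDerivAt))
  refine h3.congr_deriv ?_
  simp

/-- Second derivative of a function along a real line inside a holomorphic disc. -/
lemma hasDerivAt_deriv_comp_disc {ρ : C2 → ℝ} (hρ : AnalyticAt ℝ ρ 0) {γ : ℂ → C2}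
    (hγ : AnalyticAt ℂ γ 0) (hγ0 : γ 0 = 0) (ω : ℂ) :
    HasDerivAt (deriv fun t : ℝ => ρ (γ (t * ω)))
      (fderiv ℝ (fderiv ℝ ρ) 0 (ω • deriv γ 0) (ω • deriv γ 0)
        + fderiv ℝ ρ 0 (ω ^ 2 • deriv (deriv γ) 0)) 0 := by
  have hl : ∀ t : ℝ, HasDerivAt (fun t : ℝ => (t : ℂ) * ω) ω t := by
    intro t
    simpa using (Complex.ofRealCLM.hasDerivAt (x := t)).mul_const ω
  have tl : Tendsto (fun t : ℝ => (t : ℂ) * ω) (𝓝 0) (𝓝 0) :=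
    Continuous.tendsto' (by fun_prop) _ _ (by simp)
  have tγ : Tendsto γ (𝓝 0) (𝓝 0) := by simpa [ContinuousAt, hγ0] using hγ.continuousAt
  have h1 : (deriv fun t : ℝ => ρ (γ (t * ω))) =ᶠ[𝓝 0]
      fun t : ℝ => fderiv ℝ ρ (γ (t * ω)) (ω • deriv γ (t * ω)) := by
    filter_upwards [tl.eventually hγ.eventually_analyticAt,
      (tγ.comp tl).eventually hρ.eventually_analyticAt] with t e1 e2
    have e3 : HasDerivAt (fun t : ℝ => γ (t * ω)) (ω • deriv γ (t * ω)) t :=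
      e1.differentiableAt.hasDerivAt.scomp t (hl t)
    exact (HasFDerivAt.comp_hasDerivAt t e2.differentiableAt.hasFDerivAt e3).deriv
  refine HasDerivAt.congr_of_eventuallyEq ?_ h1
  have hl0 : HasDerivAt (fun t : ℝ => (t : ℂ) * ω) ω 0 := hl 0
  have z : ((0 : ℝ) : ℂ) * ω = 0 := by simp
  have h2 : HasDerivAt (fun t : ℝ => γ (t * ω)) (ω • deriv γ 0) 0 :=
    HasDerivAt.scomp_of_eq (0 : ℝ) hγ.differentiableAt.hasDerivAt hl0 z.symm
  have h3 : HasDerivAt (fun t : ℝ => fderiv ℝ ρ (γ (t * ω)))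
      (fderiv ℝ (fderiv ℝ ρ) 0 (ω • deriv γ 0)) 0 :=
    HasFDerivAt.comp_hasDerivAt_of_eq (0 : ℝ) hρ.fderiv.differentiableAt.hasFDerivAt h2
      (by rw [z, hγ0])
  have h4 : HasDerivAt (fun t : ℝ => ω • deriv γ (t * ω)) (ω • ω • deriv (deriv γ) 0) 0 :=
    (HasDerivAt.scomp_of_eq (0 : ℝ) hγ.deriv.differentiableAt.hasDerivAt hl0 z.symm).const_smul ω
  refine (h3.clm_apply h4).congr_deriv ?_
  simp only [z, hγ0, smul_smul, pow_two]

/-- The Levi form read off on a holomorphic disc. -/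
lemma leviForm_eq_of_disc {ρ : C2 → ℝ} (hρ : AnalyticAt ℝ ρ 0) {γ : ℂ → C2}
    (hγ : AnalyticAt ℂ γ 0) (hγ0 : γ 0 = 0) {k : ℂ → ℝ} (hk : AnalyticAt ℝ k 0)
    (h : ∀ᶠ ζ in 𝓝 0, ρ (γ ζ) = Complex.normSq ζ * k ζ) :
    leviForm ρ (deriv γ 0) = 4 * k 0 := by
  have key : ∀ ω : ℂ, Complex.normSq ω = 1 →
      fderiv ℝ (fderiv ℝ ρ) 0 (ω • deriv γ 0) (ω • deriv γ 0)
        + fderiv ℝ ρ 0 (ω ^ 2 • deriv (deriv γ) 0) = 2 * k 0 := by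
    intro ω hω
    have tl : Tendsto (fun t : ℝ => (t : ℂ) * ω) (𝓝 0) (𝓝 0) :=
      Continuous.tendsto' (by fun_prop) _ _ (by simp)
    have hm : AnalyticAt ℝ (fun t : ℝ => k (t * ω)) 0 := by
      refine AnalyticAt.fun_comp (g := k) (f := fun t : ℝ => (t : ℂ) * ω) (by simpa using hk) ?_
      exact (Complex.ofRealCLM.analyticAt _).mul analyticAt_const
    have h1 := hasDerivAt_deriv_of_eq_sq_mul (g := fun t : ℝ => ρ (γ (t * ω))) hm (by
      filter_upwards [tl.eventually h] with t ht
      rw [ht, Complex.normSq_mul, hω, Complex.normSq_ofReal]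
      ring)
    have h2 := (hasDerivAt_deriv_comp_disc hρ hγ hγ0 ω).unique h1
    simpa using h2
  -- The first-order term carries the factor `ω²`, so it cancels when the directions `1` and `i` are
  -- added.
  have h1 := key 1 (by simp)
  have h2 := key Complex.I (by simp)
  simp only [one_smul, one_pow, Complex.I_sq, neg_smul, map_neg] at h1 h2
  rw [leviForm]
  linarith

/-! ### The hypersurface as a graph -/

/-- Solving `|z|² K + v L = 0` for `v` in the form `v = |z|² F`. -/
lemma exists_graph {K : ℂ × ℝ → ℝ} {L : (ℂ × ℝ) × ℝ → ℝ} (hK : AnalyticAt ℝ K 0)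
    (hL : AnalyticAt ℝ L 0) (hL0 : L 0 ≠ 0) (hKL : K 0 = -L 0) :
    ∃ F : ℂ × ℝ → ℝ, AnalyticAt ℝ F 0 ∧ F 0 = 1 ∧ ∀ᶠ x : (ℂ × ℝ) × ℝ in 𝓝 0,
      Complex.normSq x.1.1 * K x.1 + x.2 * L x = 0 ↔ x.2 = Complex.normSq x.1.1 * F x.1 := by
  have hN : ∀ z, AnalyticAt ℝ Complex.normSq z := by
    intro z
    have : (Complex.normSq : ℂ → ℝ) = fun z => z.re * z.re + z.im * z.im := by
      ext z; exact Complex.normSq_apply z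
    rw [this]
    have h1 := Complex.reCLM.analyticAt z
    have h2 := Complex.imCLM.analyticAt z
    exact (h1.mul h1).add (h2.mul h2)
  -- This is the equation after the substitution `v = |z|² t` and division by `|z|²`.
  let f : (ℂ × ℝ) × ℝ → ℝ := fun y => K y.1 + y.2 * L (y.1, Complex.normSq y.1.1 * y.2)
  have hf : AnalyticAt ℝ f ((0 : ℂ × ℝ), (1 : ℝ)) := by
    have a11 : AnalyticAt ℝ (fun y : (ℂ × ℝ) × ℝ => y.1.1) ((0 : ℂ × ℝ), (1 : ℝ)) :=
      AnalyticAt.fun_comp (g := fun x : ℂ × ℝ => x.1) analyticAt_fst analyticAt_fst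
    have a3 : AnalyticAt ℝ (fun y : (ℂ × ℝ) × ℝ => Complex.normSq y.1.1) ((0 : ℂ × ℝ), (1 : ℝ)) :=
      AnalyticAt.fun_comp (g := Complex.normSq) (hN _) a11
    refine AnalyticAt.add (AnalyticAt.fun_comp (g := K) hK analyticAt_fst)
      (analyticAt_snd.mul (AnalyticAt.fun_comp (g := L) ?_
        (analyticAt_fst.prod (a3.mul analyticAt_snd))))
    simp only [Prod.fst_zero, map_zero, zero_mul]
    exact hL
  have hd : HasDerivAt (fun t : ℝ => f (0, t)) (L 0) 1 := by
    have e : (fun t : ℝ => f (0, t)) = fun t => K 0 + t * L 0 := by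
      ext t
      simp only [f, Prod.fst_zero, map_zero, zero_mul]
      rfl
    rw [e]
    simpa using ((hasDerivAt_id (1 : ℝ)).mul_const (L 0)).const_add (K 0)
  have hf0 : f (0, 1) = 0 := by
    have : f (0, 1) = K 0 + 1 * L 0 := by
      simp only [f, Prod.fst_zero, map_zero, zero_mul]
      rfl
    rw [this, hKL]; ring
  obtain ⟨F, hF, hF0, hiff⟩ := hf.exists_implicit hf0 hd hL0
  refine ⟨F, hF, hF0, ?_⟩
  have tL : Tendsto L (𝓝 0) (𝓝 (L 0)) := hL.continuousAt
  have t1 : Tendsto (fun x : (ℂ × ℝ) × ℝ => x.1) (𝓝 0) (𝓝 0) :=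
    continuous_fst.tendsto' _ _ rfl
  have tK : Tendsto (fun x : (ℂ × ℝ) × ℝ => K x.1) (𝓝 0) (𝓝 (K 0)) :=
    hK.continuousAt.tendsto.comp t1
  have tF : Tendsto (fun x : (ℂ × ℝ) × ℝ => (x.1, F x.1)) (𝓝 0) (𝓝 (0, 1)) := by
    have := hF.continuousAt.tendsto.comp t1
    rw [hF0] at this
    exact t1.prodMk_nhds this
  -- A solution with `z ≠ 0` has `v / |z|² = -K / L`, which tends to 1. Without this the local
  -- uniqueness of `t` near 1 would not apply to it.
  have tQ : Tendsto (fun x : (ℂ × ℝ) × ℝ => (x.1, -K x.1 / L x)) (𝓝 0) (𝓝 (0, 1)) := by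
    have h1 := (tK.neg).div tL hL0
    rw [hKL, neg_neg, div_self hL0] at h1
    exact t1.prodMk_nhds h1
  filter_upwards [tF.eventually hiff, tQ.eventually hiff, tL.eventually_ne hL0] with x e1 e2 e3
  constructor
  · intro h
    by_cases hz : Complex.normSq x.1.1 = 0
    · rw [hz, zero_mul, zero_add] at h
      rw [hz, zero_mul]
      exact (mul_eq_zero.1 h).resolve_right e3
    · have hv : Complex.normSq x.1.1 * (-K x.1 / L x) = x.2 := by
        field_simp
        linarith
      have h0 : F x.1 = -K x.1 / L x := by
        refine e2.1 ?_
        simp only [f, hv, Prod.mk.eta]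
        field_simp
        ring
      rw [h0, hv]
  · intro h
    have h0 : K x.1 + F x.1 * L (x.1, Complex.normSq x.1.1 * F x.1) = 0 := e1.2 rfl
    rw [← h, Prod.mk.eta] at h0
    calc Complex.normSq x.1.1 * K x.1 + x.2 * L x
        = Complex.normSq x.1.1 * K x.1 + (Complex.normSq x.1.1 * F x.1) * L x := by rw [← h]
      _ = Complex.normSq x.1.1 * (K x.1 + F x.1 * L x) := by ring
      _ = 0 := by rw [h0, mul_zero]

/-! ### Complexified tangent spaces in real and imaginary parts -/

section ComplexTangent

/-- The complex vector field `ξ - i (i ξ)` of type `(1, 0)`. -/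
noncomputable def CVectorField.ofHol (ξ : C2 → C2) : CVectorField where
  re := ξ
  im := fun p => -(Complex.I • ξ p)

/-- The real part of a complexified vector. -/
noncomputable def CT.rePart : CT →ₗ[ℝ] C2 :=
  (TensorProduct.lid ℝ C2).toLinearMap ∘ₗ LinearMap.rTensor C2 Complex.reLm

/-- The imaginary part of a complexified vector. -/
noncomputable def CT.imPart : CT →ₗ[ℝ] C2 :=
  (TensorProduct.lid ℝ C2).toLinearMap ∘ₗ LinearMap.rTensor C2 Complex.imLm

@[simp] lemma CT.rePart_tmul (c : ℂ) (a : C2) : CT.rePart (c ⊗ₜ[ℝ] a) = c.re • a := by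
  simp [CT.rePart]

@[simp] lemma CT.imPart_tmul (c : ℂ) (a : C2) : CT.imPart (c ⊗ₜ[ℝ] a) = c.im • a := by
  simp [CT.imPart]

lemma CT.tmul_eq (c : ℂ) (a : C2) :
    c ⊗ₜ[ℝ] a = (1 : ℂ) ⊗ₜ[ℝ] (c.re • a) + Complex.I ⊗ₜ[ℝ] (c.im • a) := by
  conv_lhs => rw [← Complex.re_add_im c]
  rw [TensorProduct.add_tmul, ← TensorProduct.smul_tmul, ← TensorProduct.smul_tmul]
  simp

lemma CT.eq_rePart_add_imPart (x : CT) :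
    x = (1 : ℂ) ⊗ₜ[ℝ] CT.rePart x + Complex.I ⊗ₜ[ℝ] CT.imPart x := by
  induction x using TensorProduct.induction_on with
  | zero => simp
  | tmul c a => rw [CT.rePart_tmul, CT.imPart_tmul, ← CT.tmul_eq]
  | add x y hx hy =>
    rw [map_add, map_add, TensorProduct.tmul_add, TensorProduct.tmul_add]
    conv_lhs => rw [hx, hy]
    abel

lemma CT.smul_tmul_one (c : ℂ) (a b : C2) :
    c • ((1 : ℂ) ⊗ₜ[ℝ] a + Complex.I ⊗ₜ[ℝ] b : CT)
      = (1 : ℂ) ⊗ₜ[ℝ] (c.re • a - c.im • b) + Complex.I ⊗ₜ[ℝ] (c.im • a + c.re • b) := by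
  rw [smul_add, TensorProduct.smul_tmul', TensorProduct.smul_tmul', CT.tmul_eq (c • 1),
    CT.tmul_eq (c • Complex.I), TensorProduct.tmul_sub, TensorProduct.tmul_add]
  simp [TensorProduct.tmul_smul, TensorProduct.tmul_neg]
  abel

/-- A real linear form on `ℂ²` in terms of its complex coefficients. -/
lemma realForm_apply (D : C2 →L[ℝ] ℝ) (a : C2) :
    D a = ((D (1, 0) - Complex.I * D (Complex.I, 0)) * a.1
      + (D (0, 1) - Complex.I * D (0, Complex.I)) * a.2 : ℂ).re := by
  have h : a = a.1.re • ((1 : ℂ), (0 : ℂ)) + a.1.im • (Complex.I, (0 : ℂ))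
      + a.2.re • ((0 : ℂ), (1 : ℂ)) + a.2.im • ((0 : ℂ), Complex.I) := by
    ext <;> simp
  conv_lhs => rw [h]
  simp only [map_add, map_smul, smul_eq_mul]
  simp
  ring

/-- The complex direction in the kernel of a real linear form. -/
noncomputable def complexKernel (D : C2 →L[ℝ] ℝ) : C2 :=
  (D (0, 1) - Complex.I * D (0, Complex.I), -(D (1, 0) - Complex.I * D (Complex.I, 0)))

lemma apply_smul_complexKernel (D : C2 →L[ℝ] ℝ) (c : ℂ) : D (c • complexKernel D) = 0 := by
  rw [realForm_apply]
  simp [complexKernel]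
  ring

lemma complexKernel_ne_zero {D : C2 →L[ℝ] ℝ} (hD : D ≠ 0) : complexKernel D ≠ 0 := by
  intro h
  have h1 := congrArg Prod.fst h
  have h2 := congrArg Prod.snd h
  simp only [complexKernel, Prod.fst_zero, Prod.snd_zero, neg_eq_zero] at h1 h2
  refine hD (ContinuousLinearMap.ext fun a => ?_)
  rw [realForm_apply, h1, h2]
  simp

/-- The complex lines in the kernel of a nonzero real linear form. -/
lemma exists_smul_complexKernel {D : C2 →L[ℝ] ℝ} (hD : D ≠ 0) {a : C2} (h1 : D a = 0)
    (h2 : D (Complex.I • a) = 0) : ∃ c : ℂ, a = c • complexKernel D := by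
  set α : ℂ := D (1, 0) - Complex.I * D (Complex.I, 0) with hα
  set β : ℂ := D (0, 1) - Complex.I * D (0, Complex.I) with hβ
  have hk : complexKernel D = (β, -α) := rfl
  have h0 : α * a.1 + β * a.2 = 0 := by
    rw [realForm_apply] at h1 h2
    apply Complex.ext
    · exact h1
    · have : α * (Complex.I • a).1 + β * (Complex.I • a).2
        = Complex.I * (α * a.1 + β * a.2) := by simp; ring
      rw [this] at h2
      rw [Complex.I_mul_re, neg_eq_zero] at h2
      exact h2
  by_cases hb : β = 0
  · have ha : α ≠ 0 := by
      intro ha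
      exact complexKernel_ne_zero hD (by rw [hk, ha, hb]; simp)
    refine ⟨-a.2 / α, ?_⟩
    rw [hk]
    have : a.1 = 0 := by
      rw [hb, zero_mul, add_zero] at h0
      exact (mul_eq_zero.1 h0).resolve_left ha
    ext1
    · simp [hb, this]
    · simp [ha]
  · refine ⟨a.1 / β, ?_⟩
    rw [hk]
    ext1
    · simp [hb]
    · simp
      field_simp
      linear_combination h0

lemma mem_complexTangent_iff (M : LocalHypersurface) (p : C2) (x : CT) :
    x ∈ M.complexTangent p ↔
      fderiv ℝ M.ρ p (CT.rePart x) = 0 ∧ fderiv ℝ M.ρ p (CT.imPart x) = 0 := by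
  constructor
  · intro h
    rw [LocalHypersurface.complexTangent, Submodule.baseChange_eq_span] at h
    induction h using Submodule.span_induction with
    | mem x hx =>
      obtain ⟨a, ha, rfl⟩ := hx
      have ha' : fderiv ℝ M.ρ p a = 0 := ha
      simp [ha']
    | zero => simp
    | add x y _ _ hx hy => simp [hx, hy]
    | smul c x _ hx =>
      have h1 : CT.rePart (c • x) = c.re • CT.rePart x - c.im • CT.imPart x := by
        conv_lhs => rw [CT.eq_rePart_add_imPart x, CT.smul_tmul_one]
        simp
      have h2 : CT.imPart (c • x) = c.im • CT.rePart x + c.re • CT.imPart x := by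
        conv_lhs => rw [CT.eq_rePart_add_imPart x, CT.smul_tmul_one]
        simp
      rw [h1, h2]
      simp [hx]
  · rintro ⟨h1, h2⟩
    rw [CT.eq_rePart_add_imPart x]
    exact add_mem (Submodule.tmul_mem_baseChange_of_mem _ h1)
      (Submodule.tmul_mem_baseChange_of_mem _ h2)

/-- The eigenvalue equation forces the imaginary part to be `-i` times the real part, so tangency
becomes two real conditions on the real part. -/
lemma mem_holTangent_iff (M : LocalHypersurface) (p : C2) (x : CT) :
    x ∈ M.holTangent p ↔ ∃ a : C2, fderiv ℝ M.ρ p a = 0 ∧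
      fderiv ℝ M.ρ p (Complex.I • a) = 0 ∧
      x = (1 : ℂ) ⊗ₜ[ℝ] a + Complex.I ⊗ₜ[ℝ] (-(Complex.I • a)) := by
  rw [LocalHypersurface.holTangent, Submodule.mem_inf, mem_complexTangent_iff,
    Module.End.mem_eigenspace_iff]
  have hJ : ∀ a b : C2, complexStructure.baseChange ℂ
      ((1 : ℂ) ⊗ₜ[ℝ] a + Complex.I ⊗ₜ[ℝ] b : CT)
        = (1 : ℂ) ⊗ₜ[ℝ] (Complex.I • a) + Complex.I ⊗ₜ[ℝ] (Complex.I • b) := by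
    intro a b
    rw [map_add, LinearMap.baseChange_tmul, LinearMap.baseChange_tmul]
    rfl
  constructor
  · rintro ⟨⟨h1, h2⟩, h3⟩
    have h4 := congrArg CT.imPart h3
    rw [CT.eq_rePart_add_imPart x, hJ, CT.smul_tmul_one] at h4
    have h5 : CT.imPart x = -(Complex.I • CT.rePart x) := by
      have h6 : Complex.I • CT.imPart x = CT.rePart x := by simpa using h4
      rw [← h6, smul_smul]
      simp
    refine ⟨CT.rePart x, h1, ?_, ?_⟩
    · rw [h5, map_neg, neg_eq_zero] at h2
      exact h2
    · conv_lhs => rw [CT.eq_rePart_add_imPart x, h5]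
  · rintro ⟨a, h1, h2, rfl⟩
    refine ⟨by simp [h1, h2], ?_⟩
    rw [hJ, CT.smul_tmul_one]
    simp [smul_smul]

end ComplexTangent

/-! ### Class I and the Levi form -/

namespace LocalHypersurface

/-- A direction field of `T^{1,0}M` along the level sets of the defining function. -/
noncomputable def holDirection (M : LocalHypersurface) (p : C2) : C2 :=
  complexKernel (fderiv ℝ M.ρ p)

lemma analyticOnNhd_holDirection (M : LocalHypersurface) :
    AnalyticOnNhd ℝ M.holDirection M.dom := by
  intro p hp
  have h : ∀ v : C2, AnalyticAt ℝ (fun p => ((fderiv ℝ M.ρ p v : ℝ) : ℂ)) p := by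
    intro v
    refine AnalyticAt.fun_comp (g := fun u : ℝ => (u : ℂ)) (Complex.ofRealCLM.analyticAt _) ?_
    exact AnalyticAt.fun_comp (g := fun D : C2 →L[ℝ] ℝ => D v)
      ((ContinuousLinearMap.apply ℝ ℝ v).analyticAt _) (M.analytic p hp).fderiv
  exact ((h _).sub (analyticAt_const.mul (h _))).prod
    ((h _).sub (analyticAt_const.mul (h _))).neg

/-- Supplies the generator on which the Class I hypothesis is tested. The real parts of `T^{1,0}`
vectors fill the complex line in the kernel of the differential, and this line is spanned by
`holDirection`. -/
lemma isGenerator_holDirection (M : LocalHypersurface) :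
    M.IsGenerator M.dom (CVectorField.ofHol M.holDirection) := by
  have hsm : ∀ c : ℂ, AnalyticOnNhd ℝ (fun p => c • M.holDirection p) M.dom := by
    intro c p hp
    exact AnalyticAt.fun_comp (g := fun a : C2 => c • a)
      (((c • ContinuousLinearMap.id ℂ C2).restrictScalars ℝ).analyticAt _)
      (M.analyticOnNhd_holDirection p hp)
  refine ⟨M.isOpen_dom, M.analyticOnNhd_holDirection, (hsm Complex.I).neg, ?_⟩
  rintro p ⟨⟨hp, hp0⟩, -⟩
  have hD := M.fderiv_ne_zero p hp hp0
  refine ⟨?_, ?_⟩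
  · intro h
    have := congrArg CT.rePart h
    simp [CVectorField.eval, CVectorField.ofHol] at this
    exact complexKernel_ne_zero hD this
  · ext x
    rw [mem_holTangent_iff, Submodule.mem_span_singleton]
    have hsmul : ∀ c : ℂ, c • (CVectorField.ofHol M.holDirection).eval p
        = (1 : ℂ) ⊗ₜ[ℝ] (c • M.holDirection p)
          + Complex.I ⊗ₜ[ℝ] (-(Complex.I • c • M.holDirection p)) := by
      intro c
      simp only [CVectorField.eval, CVectorField.ofHol]
      rw [CT.smul_tmul_one]
      congr 2 <;> ext <;> simp [Complex.ext_iff] <;> (try constructor) <;> ring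
    constructor
    · rintro ⟨a, h1, h2, rfl⟩
      obtain ⟨c, rfl⟩ := exists_smul_complexKernel hD h1 h2
      exact ⟨c, hsmul c⟩
    · rintro ⟨c, rfl⟩
      refine ⟨c • M.holDirection p, apply_smul_complexKernel _ _, ?_, hsmul c⟩
      rw [smul_smul]
      exact apply_smul_complexKernel _ _

/-- The Levi form of a hypersurface of Class I is nonzero at the origin. -/
theorem leviForm_ne_zero (M : LocalHypersurface) (hM : M.IsClassI) :
    leviForm M.ρ (M.holDirection 0) ≠ 0 := by
  intro hlevi
  set D := fderiv ℝ M.ρ 0 with hDdef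
  set ξ := M.holDirection with hξ
  have hD : D ≠ 0 := M.fderiv_ne_zero 0 M.zero_mem_dom M.ρ_zero
  have hdρ : HasFDerivAt (fderiv ℝ M.ρ) (fderiv ℝ (fderiv ℝ M.ρ) 0) 0 :=
    (M.analytic 0 M.zero_mem_dom).fderiv.differentiableAt.hasFDerivAt
  have hdξ : HasFDerivAt ξ (fderiv ℝ ξ 0) 0 :=
    (M.analyticOnNhd_holDirection 0 M.zero_mem_dom).differentiableAt.hasFDerivAt
  let m : C2 →L[ℝ] C2 := (Complex.I • ContinuousLinearMap.id ℂ C2).restrictScalars ℝ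
  have hdIξ : HasFDerivAt (fun p => Complex.I • ξ p) (m ∘L fderiv ℝ ξ 0) 0 :=
    m.hasFDerivAt.comp (0 : C2) hdξ
  -- `h1` and `h2` differentiate `dρ(ξ) = 0` and `dρ(iξ) = 0`. These identities hold at all points,
  -- not only on `M`, so every direction `a` is allowed.
  have h1 : ∀ a, fderiv ℝ (fderiv ℝ M.ρ) 0 a (ξ 0) + D (fderiv ℝ ξ 0 a) = 0 := by
    intro a
    have e := (hdρ.clm_apply hdξ).unique ((hasFDerivAt_const (0 : ℝ) (0 : C2)).congr_of_eventuallyEq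
      (.of_forall fun p => by
        have := apply_smul_complexKernel (fderiv ℝ M.ρ p) 1
        rwa [one_smul] at this))
    have := congrArg (fun l => l a) e
    simp at this
    linarith
  have h2 : ∀ a, fderiv ℝ (fderiv ℝ M.ρ) 0 a (Complex.I • ξ 0)
      + D (Complex.I • fderiv ℝ ξ 0 a) = 0 := by
    intro a
    have e := (hdρ.clm_apply hdIξ).unique
      ((hasFDerivAt_const (0 : ℝ) (0 : C2)).congr_of_eventuallyEq
      (.of_forall fun p => apply_smul_complexKernel (fderiv ℝ M.ρ p) Complex.I))
    have := congrArg (fun l => l a) e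
    simp [m] at this
    linarith
  set η : C2 := fderiv ℝ ξ 0 (Complex.I • ξ 0) - Complex.I • fderiv ℝ ξ 0 (ξ 0) with hη
  have hsymm : fderiv ℝ (fderiv ℝ M.ρ) 0 (ξ 0) (Complex.I • ξ 0)
      = fderiv ℝ (fderiv ℝ M.ρ) 0 (Complex.I • ξ 0) (ξ 0) := by
    have : IsSymmSndFDerivAt ℝ M.ρ 0 :=
      ((M.analytic 0 M.zero_mem_dom).contDiffAt (n := ⊤)).isSymmSndFDerivAt (by simp)
    exact this _ _
  -- `η` is the bracket of `ξ` with `-iξ`. It is killed by `D` by symmetry of the second derivative,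
  -- while `D (iη)` is minus the Levi form.
  have hη1 : D η = 0 := by
    rw [hη, map_sub]
    linarith [h1 (Complex.I • ξ 0), h2 (ξ 0)]
  have hη2 : D (Complex.I • η) = 0 := by
    have e : Complex.I • η
        = Complex.I • fderiv ℝ ξ 0 (Complex.I • ξ 0) + fderiv ℝ ξ 0 (ξ 0) := by
      rw [hη, smul_sub, smul_smul, Complex.I_mul_I]
      simp
    rw [e, map_add]
    rw [leviForm] at hlevi
    linarith [h1 (ξ 0), h2 (Complex.I • ξ 0)]
  obtain ⟨c, hc⟩ := exists_smul_complexKernel hD hη1 hη2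
  have hc' : η = c • ξ 0 := hc
  set Λ := CVectorField.ofHol ξ with hΛ
  have hframe := (hM M.dom Λ M.isGenerator_holDirection 0
    ⟨⟨M.zero_mem_dom, M.ρ_zero⟩, M.zero_mem_dom⟩).1
  have hbr : VectorField.lieBracket ℝ ξ (fun p => -(Complex.I • ξ p)) 0 = η := by
    rw [VectorField.lieBracket, hdIξ.fun_neg.fderiv]
    simp [m, hη]
    abel
  have hbr' : VectorField.lieBracket ℝ ξ (fun p => -(-(Complex.I • ξ p))) 0 = -η := by
    rw [VectorField.lieBracket, hdIξ.fun_neg.fun_neg.fderiv]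
    simp [m, hη]
  have hbracket : (Λ.bracket Λ.conj).eval 0 = Complex.I ⊗ₜ[ℝ] ((-2 : ℝ) • η) := by
    have e1 : VectorField.lieBracket ℝ (fun p => -(Complex.I • ξ p)) ξ 0 = -η := by
      rw [VectorField.lieBracket_swap, hbr]
    have e2 : VectorField.lieBracket ℝ (fun p => -(Complex.I • ξ p))
        (fun p => -(-(Complex.I • ξ p))) 0 = 0 := by
      rw [VectorField.lieBracket, hdIξ.fun_neg.fderiv, hdIξ.fun_neg.fun_neg.fderiv]
      simp
    simp only [hΛ, CVectorField.eval, CVectorField.bracket, CVectorField.conj, CVectorField.ofHol,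
      VectorField.lieBracket_self, e1, e2, hbr']
    rw [show -η + -η = (-2 : ℝ) • η by rw [neg_smul, two_smul, neg_add]]
    simp
  rw [Fintype.linearIndependent_iff] at hframe
  -- The bracket is `-2i` times the real vector `η = c ξ`, and `c ξ = ½ (c Λ + c̄ Λ̄)`; hence the
  -- coefficients of this linear relation.
  have h0 := hframe ![-(Complex.I * c), -(Complex.I * conj c), -1] (by
    rw [Fin.sum_univ_three]
    change -(Complex.I * c) • Λ.eval 0 + -(Complex.I * conj c) • Λ.conj.eval 0
      + (-1 : ℂ) • (Λ.bracket Λ.conj).eval 0 = 0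
    rw [hbracket, hc']
    have e1 : Λ.eval 0 = (1 : ℂ) ⊗ₜ[ℝ] ξ 0 + Complex.I ⊗ₜ[ℝ] (-(Complex.I • ξ 0)) := rfl
    have e2 : Λ.conj.eval 0 = (1 : ℂ) ⊗ₜ[ℝ] ξ 0 + Complex.I ⊗ₜ[ℝ] (-(-(Complex.I • ξ 0))) := rfl
    rw [e1, e2, CT.smul_tmul_one, CT.smul_tmul_one, CT.eq_rePart_add_imPart (_ + _)]
    have z : ∀ a b : C2, a = 0 → b = 0 →
        (1 : ℂ) ⊗ₜ[ℝ] a + Complex.I ⊗ₜ[ℝ] b = (0 : CT) := by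
      rintro a b rfl rfl
      simp
    apply z
    · ext <;> simp
    · ext <;> simp [Complex.ext_iff] <;> (try constructor) <;> ring) 2
  simp at h0

end LocalHypersurface

/-! ### Linear normalization and conclusion -/

/-- Complex linear coordinates adapted to a nonzero real linear form. -/
lemma exists_linear_coordinates {D : C2 →L[ℝ] ℝ} (hD : D ≠ 0) {ξ : C2} (hξ0 : ξ ≠ 0)
    (hξ : ∀ c : ℂ, D (c • ξ) = 0) {c : ℝ} (hc : c ≠ 0) :
    ∃ A : C2 ≃L[ℂ] C2, A (1, 0) = ξ ∧ ∀ p, D (A p) = c * p.2.im := by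
  set α : ℂ := D (1, 0) - Complex.I * D (Complex.I, 0) with hα
  set β : ℂ := D (0, 1) - Complex.I * D (0, Complex.I) with hβ
  -- The factor `i` makes `D` the imaginary part of `h`, to match `v = Im w`.
  let h : C2 →ₗ[ℂ] ℂ := Complex.I • (α • LinearMap.fst ℂ ℂ ℂ + β • LinearMap.snd ℂ ℂ ℂ)
  have hh : ∀ a, D a = (h a).im := by
    intro a
    rw [realForm_apply]
    simp only [h, LinearMap.smul_apply, smul_eq_mul, Complex.I_mul_im]
    rfl
  obtain ⟨m, hm⟩ : ∃ m, h m ≠ 0 := by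
    by_contra! hcon
    exact hD (ContinuousLinearMap.ext fun a => by rw [hh, hcon]; simp)
  set n : C2 := ((c : ℂ) / h m) • m with hn
  have hhn : h n = c := by
    rw [hn, map_smul, smul_eq_mul]
    field_simp
  have hhξ : h ξ = 0 := by
    apply Complex.ext
    · have := hξ Complex.I
      rw [hh, map_smul] at this
      simpa using this
    · have := hξ 1
      rw [hh, one_smul] at this
      simpa using this
  let A₀ : C2 →ₗ[ℂ] C2 :=
    (LinearMap.fst ℂ ℂ ℂ).smulRight ξ + (LinearMap.snd ℂ ℂ ℂ).smulRight n
  have hA₀ : ∀ p, A₀ p = p.1 • ξ + p.2 • n := fun p => rfl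
  have hhA : ∀ p, h (A₀ p) = p.2 * c := by
    intro p
    rw [hA₀, map_add, map_smul, map_smul, hhξ, hhn]
    simp
  have hinj : Function.Injective A₀ := by
    rw [← LinearMap.ker_eq_bot, LinearMap.ker_eq_bot']
    intro p hp
    have h2 : p.2 = 0 := by
      have := hhA p
      rw [hp, map_zero] at this
      have := this.symm
      simpa [hc] using this
    have h1 : p.1 = 0 := by
      rw [hA₀, h2, zero_smul, add_zero] at hp
      exact (smul_eq_zero.1 hp).resolve_right hξ0
    exact Prod.ext h1 h2
  refine ⟨(LinearEquiv.ofInjectiveEndo A₀ hinj).toContinuousLinearEquiv, ?_, ?_⟩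
  · change A₀ (1, 0) = ξ
    simp [hA₀]
  · intro p
    change D (A₀ p) = _
    rw [hh, hhA]
    simp [mul_comm]

theorem mainTheorem3 (M : LocalHypersurface) (hM : M.IsClassI) :
    ∃ (Φ : OpenPartialHomeomorph C2 C2) (A : ℂ → ℝ) (B : ℂ × ℝ → ℝ),
      IsLocalHolCoord Φ ∧ Φ.source ⊆ M.dom ∧
      AnalyticOnNhd ℝ A ((fun q : C2 => q.1) '' Φ.target) ∧ A 0 = 0 ∧
      AnalyticOnNhd ℝ B ((fun q : C2 => (q.1, q.2.re)) '' Φ.target) ∧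
      ∀ p ∈ Φ.source, p ∈ M.carrier ↔
        (Φ p).2.im = Complex.normSq (Φ p).1
          + Complex.normSq (Φ p).1 * A (Φ p).1
          + Complex.normSq (Φ p).1 * ((Φ p).2.re * B ((Φ p).1, (Φ p).2.re)) := by
  have hρ : AnalyticAt ℝ M.ρ 0 := M.analytic 0 M.zero_mem_dom
  have hD : fderiv ℝ M.ρ 0 ≠ 0 := M.fderiv_ne_zero 0 M.zero_mem_dom M.ρ_zero
  have hlevi := M.leviForm_ne_zero hM
  set ξ := M.holDirection 0 with hξ
  -- Below, `L 0 = c` and `4 K 0` is the Levi form, so this choice gives `K 0 = -L 0`. The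
  -- coefficient of `|z|²` in the graph is then 1, with no later rescaling.
  obtain ⟨c, hcdef⟩ : ∃ c, c = -(leviForm M.ρ ξ / 4) := ⟨_, rfl⟩
  have hc : c ≠ 0 := by rw [hcdef]; simpa using hlevi
  obtain ⟨T, hT1, hT2⟩ := exists_linear_coordinates hD (complexKernel_ne_zero hD)
    (apply_smul_complexKernel _) hc
  have hρT : AnalyticAt ℝ (fun p => M.ρ (T p)) 0 :=
    AnalyticAt.fun_comp (g := M.ρ) (by rw [map_zero]; exact hρ)
      (((T : C2 →L[ℂ] C2).restrictScalars ℝ).analyticAt _)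
  have hdT : ∀ p, fderiv ℝ (fun p => M.ρ (T p)) 0 p = c * p.2.im := by
    intro p
    have h1 : HasFDerivAt (fun p => M.ρ (T p))
        (fderiv ℝ M.ρ 0 ∘L (T : C2 →L[ℂ] C2).restrictScalars ℝ) 0 :=
      HasFDerivAt.comp (0 : C2) (by rw [map_zero]; exact hρ.differentiableAt.hasFDerivAt)
        ((T : C2 →L[ℂ] C2).restrictScalars ℝ).hasFDerivAt
    rw [h1.fderiv, ← hT2]
    rfl
  obtain ⟨Φ, K, L, hsrc, hΦ0, hΦ, hΨ, hΨd, hK, hL, hKL⟩ :=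
    exists_normal_coordinates hc hρT (by rw [map_zero]; exact M.ρ_zero) hdT
  have hΨ0 : Φ.symm 0 = 0 := by
    conv_lhs => rw [← hΦ0]
    exact Φ.left_inv hsrc
  -- On the line `z = 0`, `u = 0` the normal form reads `ρ = v L`; compare derivatives at `v = 0`.
  have hL0 : L 0 = c := by
    have t : Tendsto (fun v : ℝ => ((0 : ℂ × ℝ), v)) (𝓝 0) (𝓝 0) :=
      Continuous.tendsto' (by fun_prop) _ _ rfl
    have h1 : HasDerivAt (fun v : ℝ => ((0 : ℂ), (v : ℂ) * Complex.I)) (0, Complex.I) 0 := by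
      have := (Complex.ofRealCLM.hasDerivAt (x := (0 : ℝ))).mul_const Complex.I
      exact (hasDerivAt_const _ _).prodMk (by simpa using this)
    have h2 : HasDerivAt (fun v : ℝ => Φ.symm ((0 : ℂ), (v : ℂ) * Complex.I)) (0, Complex.I) 0 :=
      HasFDerivAt.comp_hasDerivAt_of_eq (0 : ℝ) (hΨd.restrictScalars ℝ) h1 (by simp; rfl)
    have h3 : HasDerivAt (fun v : ℝ => M.ρ (T (Φ.symm ((0 : ℂ), (v : ℂ) * Complex.I)))) c 0 := by
      have := HasFDerivAt.comp_hasDerivAt_of_eq (0 : ℝ) hρT.differentiableAt.hasFDerivAt h2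
        (by rw [Complex.ofReal_zero, zero_mul]; exact hΨ0.symm)
      rw [hdT, Complex.I_im, mul_one] at this
      exact this
    have h4 : HasDerivAt (fun v : ℝ => L ((0 : ℂ × ℝ), v)) (deriv (fun v : ℝ => L (0, v)) 0) 0 :=
      (AnalyticAt.fun_comp (g := L) (f := fun v : ℝ => ((0 : ℂ × ℝ), v)) hL
        (analyticAt_const.prod analyticAt_id)).differentiableAt.hasDerivAt
    have h5 := (hasDerivAt_id (0 : ℝ)).mul h4
    have h6 := h3.unique (h5.congr_of_eventuallyEq (by
      filter_upwards [t.eventually hKL] with v hv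
      simpa using hv))
    rw [h6]
    simp
    rfl
  -- On the disc `w = 0` the normal form reads `ρ = |ζ|² K (ζ, 0)`, and the disc is tangent to `ξ`
  -- at the origin.
  have hK0 : leviForm M.ρ ξ = 4 * K 0 := by
    have h1 : HasDerivAt (fun ζ : ℂ => T (Φ.symm (ζ, 0))) ξ 0 := by
      have h2 : HasDerivAt (fun ζ : ℂ => (ζ, (0 : ℂ))) (1, 0) 0 :=
        (hasDerivAt_id _).prodMk (hasDerivAt_const _ _)
      have h3 : HasDerivAt (fun ζ : ℂ => Φ.symm (ζ, (0 : ℂ))) (1, 0) 0 :=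
        HasFDerivAt.comp_hasDerivAt_of_eq (0 : ℂ) hΨd h2 rfl
      have h4 := (T : C2 →L[ℂ] C2).hasFDerivAt.comp_hasDerivAt (0 : ℂ) h3
      have h5 : (T : C2 →L[ℂ] C2) (1, 0) = ξ := hT1
      rw [h5] at h4
      exact h4
    have h2 : AnalyticAt ℂ (fun ζ : ℂ => T (Φ.symm (ζ, 0))) 0 :=
      AnalyticAt.fun_comp (g := T) ((T : C2 →L[ℂ] C2).analyticAt _)
        (AnalyticAt.fun_comp (g := Φ.symm) (f := fun ζ : ℂ => (ζ, (0 : ℂ))) hΨ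
          (analyticAt_id.prod analyticAt_const))
    have h3 : AnalyticAt ℝ (fun ζ : ℂ => K (ζ, 0)) 0 :=
      AnalyticAt.fun_comp (g := K) (f := fun ζ : ℂ => (ζ, (0 : ℝ))) hK
        (analyticAt_id.prod analyticAt_const)
    have t : Tendsto (fun ζ : ℂ => ((ζ, (0 : ℝ)), (0 : ℝ))) (𝓝 0) (𝓝 0) :=
      Continuous.tendsto' (by fun_prop) _ _ rfl
    have h0 : T (Φ.symm ((0 : ℂ), (0 : ℂ))) = 0 := by
      have : Φ.symm ((0 : ℂ), (0 : ℂ)) = 0 := hΨ0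
      rw [this, map_zero]
    have := leviForm_eq_of_disc hρ h2 h0 h3 (by
      filter_upwards [t.eventually hKL] with ζ hζ
      simpa using hζ)
    rw [h1.deriv] at this
    exact this
  obtain ⟨F, hF, hF0, hgraph⟩ := exists_graph hK hL (by rw [hL0]; exact hc)
    (by rw [hL0, hcdef, hK0]; ring)
  -- Division by `u` separates `F (z, 0) = 1 + A z` from the part carrying the factor `u`.
  obtain ⟨B, hB, hFB⟩ := hF.exists_eq_add_smul (ContinuousLinearMap.snd ℝ ℂ ℝ) (0, 1)
  let A : ℂ → ℝ := fun z => F (z, 0) - 1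
  have hA : AnalyticAt ℝ A 0 :=
    (AnalyticAt.fun_comp (g := F) (f := fun z : ℂ => (z, (0 : ℝ))) hF
      (analyticAt_id.prod analyticAt_const)).sub analyticAt_const
  let Φ' : OpenPartialHomeomorph C2 C2 :=
    T.symm.toHomeomorph.toOpenPartialHomeomorph.trans Φ
  have hΦ' : ∀ p, Φ' p = Φ (T.symm p) := fun p => rfl
  have hΦ's : ∀ q, Φ'.symm q = T (Φ.symm q) := fun q => rfl
  have hsrc' : (0 : C2) ∈ Φ'.source := by
    simp [Φ', hsrc]
  have hΦ'0 : Φ' 0 = 0 := by rw [hΦ', map_zero, hΦ0]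
  have hΦ'a : AnalyticAt ℂ Φ' 0 :=
    AnalyticAt.fun_comp (g := Φ) (f := T.symm) (by rw [map_zero]; exact hΦ)
      ((T.symm : C2 →L[ℂ] C2).analyticAt _)
  have hΨ'a : AnalyticAt ℂ Φ'.symm 0 :=
    AnalyticAt.fun_comp (g := T) ((T : C2 →L[ℂ] C2).analyticAt _) hΨ
  have tre : Tendsto (fun q : C2 => (q.1, q.2.re)) (𝓝 0) (𝓝 0) :=
    Continuous.tendsto' (by fun_prop) _ _ rfl
  have tim : Tendsto (fun q : C2 => ((q.1, q.2.re), q.2.im)) (𝓝 0) (𝓝 0) :=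
    Continuous.tendsto' (by fun_prop) _ _ rfl
  have tfst : Tendsto (fun q : C2 => q.1) (𝓝 0) (𝓝 0) :=
    Continuous.tendsto' (by fun_prop) _ _ rfl
  have hev : ∀ᶠ q : C2 in 𝓝 0, AnalyticAt ℝ A q.1 ∧ AnalyticAt ℝ B (q.1, q.2.re) ∧
      AnalyticAt ℂ Φ'.symm q ∧
      (M.ρ (Φ'.symm q) = 0 ↔ q.2.im = Complex.normSq q.1 + Complex.normSq q.1 * A q.1
        + Complex.normSq q.1 * (q.2.re * B (q.1, q.2.re))) := by
    filter_upwards [tfst.eventually hA.eventually_analyticAt,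
      tre.eventually hB.eventually_analyticAt, hΨ'a.eventually_analyticAt, tim.eventually hKL,
      tim.eventually hgraph, tre.eventually hFB] with q e1 e2 e3 e4 e5 e6
    refine ⟨e1, e2, e3, ?_⟩
    rw [Complex.re_add_im] at e4
    rw [hΦ's, e4, e5, e6]
    have : ((q.1, q.2.re) : ℂ × ℝ) - (ContinuousLinearMap.snd ℝ ℂ ℝ) (q.1, q.2.re) • ((0 : ℂ), (1 : ℝ))
        = (q.1, 0) := by ext <;> simp
    rw [this]
    have : F (q.1, 0) + (ContinuousLinearMap.snd ℝ ℂ ℝ) (q.1, q.2.re) • B (q.1, q.2.re)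
        = 1 + A q.1 + q.2.re * B (q.1, q.2.re) := by
      simp [A]
    rw [this, mul_add, mul_add, mul_one]
  have tΦ' : Tendsto Φ' (𝓝 0) (𝓝 0) := by simpa [ContinuousAt, hΦ'0] using hΦ'a.continuousAt
  -- All the local statements hold on one open set; restricting the chart to it makes them valid on
  -- the whole source and target.
  obtain ⟨U, hU, hUo, hU0⟩ := eventually_nhds_iff.1 ((tΦ'.eventually hev).and
    (hΦ'a.eventually_analyticAt.and (M.isOpen_dom.mem_nhds M.zero_mem_dom)))
  have hres : (Φ'.restrOpen U hUo).source = Φ'.source ∩ U := Φ'.restrOpen_source U hUo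
  have htgt : ∀ q ∈ (Φ'.restrOpen U hUo).target, Φ'.symm q ∈ U ∧ Φ' (Φ'.symm q) = q := by
    intro q hq
    have h1 := (Φ'.restrOpen U hUo).map_target hq
    have h2 := (Φ'.restrOpen U hUo).right_inv hq
    rw [hres] at h1
    exact ⟨h1.2, h2⟩
  refine ⟨Φ'.restrOpen U hUo, A, B, ⟨?_, hΦ'0, ?_, ?_⟩, ?_, ?_, ?_, ?_, ?_⟩
  · rw [hres]
    exact ⟨hsrc', hU0⟩
  · intro p hp
    rw [hres] at hp
    exact (hU p hp.2).2.1.differentiableAt.differentiableWithinAt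
  · intro q hq
    obtain ⟨h1, h2⟩ := htgt q hq
    have h3 := (hU _ h1).1.2.2.1
    rw [h2] at h3
    exact h3.differentiableAt.differentiableWithinAt
  · intro p hp
    rw [hres] at hp
    exact (hU p hp.2).2.2
  · rintro _ ⟨q, hq, rfl⟩
    obtain ⟨h1, h2⟩ := htgt q hq
    have h3 := (hU _ h1).1.1
    rwa [h2] at h3
  · have : F (0, 0) = 1 := hF0
    simp [A, this]
  · rintro _ ⟨q, hq, rfl⟩
    obtain ⟨h1, h2⟩ := htgt q hq
    have h3 := (hU _ h1).1.2.1
    rwa [h2] at h3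
  · intro p hp
    rw [hres] at hp
    have h1 := (hU p hp.2).1.2.2.2
    rw [Φ'.left_inv hp.1] at h1
    have h2 : p ∈ M.dom := (hU p hp.2).2.2
    exact ⟨fun h => h1.1 h.2, fun h => ⟨h2, h1.2 h⟩⟩
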